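/- Let $n\ge 2$ and $1\le \ell,k\le n-1$. Let $\mathrm{Gr}(k,n)$ be the Grassmannian of $k$-dimensional subspaces of $\mathbb{C}^n$ and $X_k=\mathrm{Gr}(k,n)\times\mathbb{C}^\times$, with points written $N|t$. For a finite set $I$ of integers let $P_I(N)$ be the Plücker coordinate of $N$ indexed by the set of residues of the elements of $I$ modulo $n$ in $[n]=\{1,\dots,n\}$ (the minor, on these rows in increasing order, of an $n\times k$ matrix with column span $N$), with $P_I(N)=0$ if there are not exactly $k$ such residues; these coordinates are defined up to a common nonzero scalar. For integers $a,b$ let $[a,b]=\{m\in\mathbb{Z}: a\le m\le b\}$. Let $B^-\subset \mathrm{GL}_n(\mathbb{C}(\lambda))$ be the monoid of $n\times n$ matrices with entries in $\mathbb{C}[\lambda]$ whose diagonal entries have nonzero constant term and whose entries above the diagonal have zero constant term. Let $g:X_k\to B^-$ be the rational map $g(N|t)=A$, $$A_{ij}=c_{ij}\,\frac{P_{[j-k+1,\,j-1]\cup\{i\}}(N)}{P_{[j-k,\,j-1]}(N)},\qquad c_{ij}=\begin{cases}1 & j\le k\\ t & j>k,\ i\ge j\\ \lambda & j>k,\ i<j,\end{cases}$$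 which is defined if and only if $P_{[j-k,j-1]}(N)\neq 0$ for all $j\in[n]$. For $z\in\mathbb{C}^\times$ and an $n\times n$ matrix $A$ over $\mathbb{C}[\lambda]$, let $\pi^k_z(A)=N|z$, where $N$ is the span of the first $k$ columns of $A|_{\lambda=(-1)^{k-1}z}$; this is undefined if these columns are linearly dependent. Let $\mathrm{fl}(A)_{ij}=A_{n-j+1,\,n-i+1}$, let $S:X_k\to X_k$ be the rational map $S(N|t)=\pi^k_t(\mathrm{fl}(g(N|t)))$, and put $S(x,y)=(S(y),S(x))$ on pairs. Let $\Psi_{k,\ell}:X_\ell\times X_k\to X_k$ be the rational map $\Psi_{k,\ell}(M|s,N|t)=\pi^k_t\big(g(M|s)\,g(N|t)\big)$. The geometric $R$-matrix is the rational map $$R=(\Psi_{k,\ell},\; S\circ\Psi_{\ell,k}\circ S):\ X_\ell\times X_k\to X_k\times X_\ell .$$ All compositions are compositions of partially defined maps. **Theorem.** The identity $g\circ R=g$ of rational maps $X_\ell\times X_k\to B^-$ holds, where $g(x,y)=g(x)g(y)$ on pairs. That is: 1. if $R(u,v)$ is defined, $R(u,v)=(v',u')$, and $g(v')$ and $g(u')$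 are defined, then $g(u)$ and $g(v)$ are defined and $$g(u)\,g(v)=g(v')\,g(u')\quad\text{in } \mathrm{GL}_n(\mathbb{C}(\lambda));$$ 2. the set of $(u,v)\in X_\ell\times X_k$ at which $R$ is defined with $g(v')$ and $g(u')$ defined contains a nonempty (hence dense) Zariski-open subset of $X_\ell\times X_k$. -/

import Mathlib

open scoped Polynomial

noncomputable section

namespace GeomR

/-! ### The Grassmannian and Plücker coordinates -/

/-- `Gr k n`: the Grassmannian of `k`-dimensional subspaces of `ℂⁿ`. -/
abbrev Gr (k n : ℕ) : Type :=
  {N : Submodule ℂ (Fin n → ℂ) // Module.finrank ℂ N = k}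

/-- `X n k = Gr(k,n) × ℂˣ`; the point `(N, t)` is written `N|t` on paper. -/
abbrev X (n k : ℕ) : Type := Gr k n × ℂˣ

/-- `Z` is an `n × k` matrix representative of `N`: its column span is `N`
(so `Z` automatically has full rank `k`). -/
def IsRep {n k : ℕ} (Z : Matrix (Fin n) (Fin k) ℂ) (N : Gr k n) : Prop :=
  Submodule.span ℂ (Set.range Z.col) = N.1

/-- The subset of `[n]` of residues modulo `n` of a finite set `I` of integers. The element
`a : Fin n` stands for the row with number `a + 1 ∈ [n]`. -/
def residues (n : ℕ) (I : Finset ℤ) : Finset (Fin n) :=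
  Finset.univ.filter fun a => ∃ m ∈ I, m ≡ (a : ℤ) + 1 [ZMOD n]

/-- The maximal minor of `Z` that uses the rows in `I`, in increasing order; `0` if `I` does not
have exactly `k` elements. -/
def minor {n k : ℕ} (Z : Matrix (Fin n) (Fin k) ℂ) (I : Finset (Fin n)) : ℂ :=
  if h : I.card = k then (Z.submatrix (I.orderEmbOfFin h) id).det else 0

/-- The Plücker coordinate `P_I` of the matrix `Z`, for a finite set `I` of integers, which are
read modulo `n`. -/
def plucker {n k : ℕ} (Z : Matrix (Fin n) (Fin k) ℂ) (I : Finset ℤ) : ℂ :=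
  minor Z (residues n I)

/-- All cyclic Plücker coordinates `P_{[j-k, j-1]}`, `j ∈ [n]`, of `Z` are nonzero. -/
def CyclicNonzero {n k : ℕ} (Z : Matrix (Fin n) (Fin k) ℂ) : Prop :=
  ∀ j : ℤ, 1 ≤ j → j ≤ n → plucker Z (Finset.Icc (j - k) (j - 1)) ≠ 0

/-- The coefficient `c_{ij}` (`i`, `j` are one-based); the variable `X` of `ℂ[X]` is the loop
parameter `λ`. -/
def coeffC (k : ℕ) (t : ℂ) (i j : ℤ) : ℂ[X] :=
  if j ≤ k then 1 else if j ≤ i then Polynomial.C t else Polynomial.X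

/-- The folded matrix with entries `c_{ij} P_{[j-k+1,j-1] ∪ {i}} / P_{[j-k,j-1]}`, computed
from a matrix representative `Z`. -/
def gMatrix {n k : ℕ} (Z : Matrix (Fin n) (Fin k) ℂ) (t : ℂ) : Matrix (Fin n) (Fin n) ℂ[X] :=
  Matrix.of fun a b =>
    let i : ℤ := (a : ℤ) + 1
    let j : ℤ := (b : ℤ) + 1
    coeffC k t i j *
      Polynomial.C (plucker Z (insert i (Finset.Icc (j - k + 1) (j - 1))) /
        plucker Z (Finset.Icc (j - k) (j - 1)))

/-- Every point of the Grassmannian has a matrix representative. -/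
theorem exists_isRep {n k : ℕ} (N : Gr k n) : ∃ Z : Matrix (Fin n) (Fin k) ℂ, IsRep Z N := by
  obtain ⟨N, hN⟩ := N
  let b := Module.finBasisOfFinrankEq ℂ N hN
  refine ⟨Matrix.of fun i j => (b j : Fin n → ℂ) i, ?_⟩
  have : (Matrix.of fun i j => (b j : Fin n → ℂ) i : Matrix (Fin n) (Fin k) ℂ).col
      = N.subtype ∘ b := by
    ext j i; rfl
  rw [IsRep, this, Set.range_comp, Submodule.span_image, b.span_eq, Submodule.map_top,
    Submodule.range_subtype]

/-- A matrix representative of `N`. -/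
def rep {n k : ℕ} (N : Gr k n) : Matrix (Fin n) (Fin k) ℂ := (exists_isRep N).choose

theorem rep_spec {n k : ℕ} (N : Gr k n) : IsRep (rep N) N := (exists_isRep N).choose_spec

/-- Two representatives of the same subspace have proportional Plücker coordinates. -/
theorem plucker_proportional {n k : ℕ} {N : Gr k n} {Z W : Matrix (Fin n) (Fin k) ℂ}
    (hZ : IsRep Z N) (hW : IsRep W N) :
    ∃ c : ℂ, c ≠ 0 ∧ ∀ I, plucker W I = c * plucker Z I := by
  have key : ∀ {Z W : Matrix (Fin n) (Fin k) ℂ}, IsRep Z N → IsRep W N →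
      ∃ C : Matrix (Fin k) (Fin k) ℂ, W = Z * C := by
    intro Z W hZ hW
    have h : ∀ j, ∃ v : Fin k → ℂ, Z.mulVec v = W.col j := by
      intro j
      have : W.col j ∈ Submodule.span ℂ (Set.range Z.col) := by
        rw [hZ, ← hW]; exact Submodule.subset_span ⟨j, rfl⟩
      rw [← Matrix.range_mulVecLin] at this
      exact this
    choose v hv using h
    refine ⟨Matrix.of fun i j => v j i, ?_⟩
    ext i j
    exact (congrFun (hv j) i).symm
  have hmul : ∀ (Z : Matrix (Fin n) (Fin k) ℂ) (C : Matrix (Fin k) (Fin k) ℂ) (I),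
      plucker (Z * C) I = C.det * plucker Z I := by
    intro Z C I
    unfold plucker minor
    split_ifs with h
    · rw [mul_comm, ← Matrix.det_mul]
      rfl
    · simp
  obtain ⟨C, rfl⟩ := key hZ hW
  refine ⟨C.det, ?_, hmul Z C⟩
  obtain ⟨D, hD⟩ := key hW hZ
  have hli : LinearIndependent ℂ Z.col := by
    rw [linearIndependent_iff_card_eq_finrank_span, Set.finrank]
    have : Submodule.span ℂ (Set.range Z.col) = N.1 := hZ
    rw [this, N.2, Fintype.card_fin]
  have hinj : Function.Injective Z.mulVec := Matrix.mulVec_injective_iff.2 hli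
  have h1 : C * D = 1 := by
    apply Matrix.ext_of_mulVec_single
    intro i
    apply hinj
    rw [Matrix.mulVec_mulVec, Matrix.mulVec_mulVec, ← Matrix.mul_assoc, ← hD, Matrix.mul_one]
  intro h0
  have := congrArg Matrix.det h1
  rw [Matrix.det_mul, h0] at this
  simp at this

/-- The domain condition does not depend on the representative. -/
theorem cyclicNonzero_congr {n k : ℕ} {N : Gr k n} {Z W : Matrix (Fin n) (Fin k) ℂ}
    (hZ : IsRep Z N) (hW : IsRep W N) : CyclicNonzero Z ↔ CyclicNonzero W := by
  obtain ⟨c, hc, h⟩ := plucker_proportional hZ hW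
  simp [CyclicNonzero, h, hc]

/-- The matrix `gMatrix Z t` does not depend on the representative `Z`. -/
theorem gMatrix_congr {n k : ℕ} {N : Gr k n} {Z W : Matrix (Fin n) (Fin k) ℂ}
    (hZ : IsRep Z N) (hW : IsRep W N) (t : ℂ) : gMatrix Z t = gMatrix W t := by
  obtain ⟨c, hc, h⟩ := plucker_proportional hZ hW
  ext1 a b
  simp only [gMatrix, Matrix.of_apply, h, mul_div_mul_left _ _ hc]

/-! ### The monoid `B⁻` and the loop group -/

/-- `B⁻`: the folded matrices with polynomial entries whose diagonal entries have nonzero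
constant term and whose entries above the diagonal have no constant term. -/
def Bminus (n : ℕ) : Submonoid (Matrix (Fin n) (Fin n) ℂ[X]) where
  carrier := {A | (∀ i, (A i i).coeff 0 ≠ 0) ∧ ∀ i j, i < j → (A i j).coeff 0 = 0}
  one_mem' := by
    refine ⟨fun i => by simp, fun i j h => by simp [Matrix.one_apply_ne h.ne]⟩
  mul_mem' := by
    rintro A B ⟨hA, hA'⟩ ⟨hB, hB'⟩
    refine ⟨fun i => ?_, fun i j hij => ?_⟩
    · rw [Matrix.mul_apply, Polynomial.finsetSum_coeff, Finset.sum_eq_single i]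
      · rw [Polynomial.mul_coeff_zero]; exact mul_ne_zero (hA i) (hB i)
      · intro l _ hl
        rw [Polynomial.mul_coeff_zero]
        rcases lt_or_gt_of_ne hl with h | h
        · rw [hB' l i h, mul_zero]
        · rw [hA' i l h, zero_mul]
      · simp
    · rw [Matrix.mul_apply, Polynomial.finsetSum_coeff]
      refine Finset.sum_eq_zero fun l _ => ?_
      rw [Polynomial.mul_coeff_zero]
      rcases lt_or_ge i l with h | h
      · rw [hA' i l h, zero_mul]
      · rw [hB' l j (h.trans_lt hij), mul_zero]

theorem Bminus_det_ne_zero {n : ℕ} (A : Bminus n) : A.1.det ≠ 0 := by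
  obtain ⟨A, hA, hA'⟩ := A
  intro h
  have h1 : (A.map (Polynomial.constantCoeff (R := ℂ))).det = 0 := by
    have := congrArg (Polynomial.constantCoeff (R := ℂ)) h
    rwa [RingHom.map_det, map_zero] at this
  rw [Matrix.det_of_isLowerTriangular] at h1
  · exact (Finset.prod_ne_zero_iff.2 fun i _ => hA i) h1
  · intro i j hij
    exact hA' i j hij

/-- The inclusion of `B⁻` in the loop group `GL_n(ℂ(λ))`. -/
def toLoop (n : ℕ) : Bminus n →* GL (Fin n) (RatFunc ℂ) where
  toFun A := Matrix.GeneralLinearGroup.mkOfDetNeZero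
    (A.1.map (algebraMap ℂ[X] (RatFunc ℂ))) (by
      rw [← RingHom.mapMatrix_apply, ← RingHom.map_det]
      exact (map_ne_zero_iff _ (IsFractionRing.injective ℂ[X] (RatFunc ℂ))).2
        (Bminus_det_ne_zero A))
  map_one' := by
    apply Units.ext
    exact Matrix.map_one _ (map_zero _) (map_one _)
  map_mul' A B := by
    apply Units.ext
    exact Matrix.map_mul

/-! ### The matrix-valued rational map `g` -/

theorem residues_add (n : ℕ) (a b : ℤ) :
    residues n (Finset.Icc (a + n) (b + n)) = residues n (Finset.Icc a b) := by
  ext x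
  simp only [residues, Finset.mem_filter, Finset.mem_univ, true_and, Finset.mem_Icc]
  constructor
  · rintro ⟨m, ⟨h1, h2⟩, h3⟩
    refine ⟨m - n, ⟨by omega, by omega⟩, ?_⟩
    refine Int.ModEq.trans ?_ h3
    exact (Int.modEq_iff_dvd.2 ⟨1, by ring⟩)
  · rintro ⟨m, ⟨h1, h2⟩, h3⟩
    refine ⟨m + n, ⟨by omega, by omega⟩, ?_⟩
    refine Int.ModEq.trans ?_ h3
    exact (Int.modEq_iff_dvd.2 ⟨-1, by ring⟩)

theorem gMatrix_mem {n k : ℕ} [NeZero k] (Z : Matrix (Fin n) (Fin k) ℂ) (hZ : CyclicNonzero Z)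
    (t : ℂˣ) : gMatrix Z (t : ℂ) ∈ Bminus n := by
  have hk : 0 < k := Nat.pos_of_ne_zero (NeZero.ne k)
  refine ⟨fun a => ?_, fun a b hab => ?_⟩
  · have ha := a.2
    have hins : insert ((a : ℤ) + 1) (Finset.Icc ((a : ℤ) + 1 - k + 1) ((a : ℤ) + 1 - 1))
        = Finset.Icc ((a : ℤ) + 2 - k) ((a : ℤ) + 2 - 1) := by
      ext m
      simp only [Finset.mem_insert, Finset.mem_Icc]
      omega
    have hnum : plucker Z (Finset.Icc ((a : ℤ) + 2 - k) ((a : ℤ) + 2 - 1)) ≠ 0 := by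
      by_cases h : (a : ℤ) + 2 ≤ n
      · exact hZ _ (by omega) h
      · have hn : (a : ℤ) + 2 = 1 + n := by omega
        have h1 := hZ 1 le_rfl (by omega)
        unfold plucker at h1 ⊢
        rwa [hn, show (1 + n - k : ℤ) = 1 - k + n by ring,
          show (1 + n - 1 : ℤ) = 1 - 1 + n by ring, residues_add]
    have hden := hZ ((a : ℤ) + 1) (by omega) (by omega)
    simp only [gMatrix, Matrix.of_apply, hins, Polynomial.mul_coeff_zero, Polynomial.coeff_C_zero]
    refine mul_ne_zero ?_ (div_ne_zero hnum hden)
    unfold coeffC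
    split_ifs <;> simp_all
  · have hab' : (a : ℕ) < b := hab
    simp only [gMatrix, Matrix.of_apply, Polynomial.mul_coeff_zero, Polynomial.coeff_C_zero]
    unfold coeffC
    split_ifs with h1 h2
    · have hmem : insert ((a : ℤ) + 1) (Finset.Icc ((b : ℤ) + 1 - k + 1) ((b : ℤ) + 1 - 1))
          = Finset.Icc ((b : ℤ) + 1 - k + 1) ((b : ℤ) + 1 - 1) := by
        apply Finset.insert_eq_of_mem
        simp only [Finset.mem_Icc]
        omega
      have hcard : (residues n (Finset.Icc ((b : ℤ) + 1 - k + 1) ((b : ℤ) + 1 - 1))).card < k := by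
        have hle : (residues n (Finset.Icc ((b : ℤ) + 1 - k + 1) ((b : ℤ) + 1 - 1))).card
            ≤ (Finset.Icc ((b : ℤ) + 1 - k + 1) ((b : ℤ) + 1 - 1)).card := by
          apply Finset.card_le_card_of_forall_subsingleton
            (fun (x : Fin n) (m : ℤ) => m ≡ (x : ℤ) + 1 [ZMOD n])
          · intro x hx
            simpa only [residues, Finset.mem_filter, Finset.mem_univ, true_and] using hx
          · rintro m _ x ⟨_, hx⟩ y ⟨_, hy⟩
            have hxy : (x : ℤ) + 1 ≡ y + 1 [ZMOD n] := hx.symm.trans hy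
            have hxy' : (x : ℤ) ≡ y [ZMOD n] := Int.ModEq.add_right_cancel' 1 hxy
            apply Fin.ext
            have := Int.natCast_modEq_iff.1 hxy'
            rwa [Nat.ModEq, Nat.mod_eq_of_lt x.2, Nat.mod_eq_of_lt y.2] at this
        rw [Int.card_Icc] at hle
        omega
      have h0 : plucker Z (Finset.Icc ((b : ℤ) + 1 - k + 1) ((b : ℤ) + 1 - 1)) = 0 := by
        unfold plucker minor
        exact dif_neg hcard.ne
      rw [hmem, h0, zero_div, mul_zero]
    · omega
    · simp

/-- The rational map `g : X_k → B⁻`. It is defined at `N|t` if and only if every cyclic Plücker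
coordinate of `N` is nonzero. -/
def g {n k : ℕ} [NeZero k] : X n k →. Bminus n := fun x =>
  ⟨CyclicNonzero (rep x.1), fun h => ⟨gMatrix (rep x.1) x.2, gMatrix_mem _ h _⟩⟩

/-- The product map `g : X_ℓ × X_k → B⁻`, `g(u, v) = g(u) g(v)`. -/
def gProd {n ℓ k : ℕ} [NeZero ℓ] [NeZero k] : X n ℓ × X n k →. Bminus n := fun p =>
  g p.1 * g p.2

/-! ### The geometric R-matrix -/

/-- The span of the first `k` columns of a complex `n × n` matrix. -/
def firstCols {n : ℕ} (k : ℕ) (A : Matrix (Fin n) (Fin n) ℂ) : Submodule ℂ (Fin n → ℂ) :=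
  Submodule.span ℂ (A.col '' {j : Fin n | (j : ℕ) < k})

/-- The rational map `π^k_z`, `A ↦ N|z`, where `N` is the span of the first `k` columns of
`A|_{λ = (-1)^{k-1} z}`. It is undefined if these columns do not have full rank. -/
def evalProj {n : ℕ} (k : ℕ) (z : ℂˣ) : Matrix (Fin n) (Fin n) ℂ[X] →. X n k := fun A =>
  let N := firstCols k (A.map (Polynomial.eval ((-1) ^ (k - 1) * (z : ℂ))))
  ⟨Module.finrank ℂ N = k, fun h => (⟨N, h⟩, z)⟩

/-- The flip map: reflection of a matrix in the anti-diagonal. -/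
def fl {n : ℕ} {α : Type*} (A : Matrix (Fin n) (Fin n) α) : Matrix (Fin n) (Fin n) α :=
  Matrix.of fun i j => A j.rev i.rev

/-- The geometric Schützenberger involution `S(N|t) = π^k_t (fl (g (N|t)))`. -/
def S {n k : ℕ} [NeZero k] : X n k →. X n k := fun x =>
  (g x).bind fun A => evalProj k x.2 (fl A.1)

/-- The map `S` on a product of two factors, `S(u, v) = (S(v), S(u))`. -/
def S₂ {n ℓ k : ℕ} [NeZero ℓ] [NeZero k] : X n ℓ × X n k →. X n k × X n ℓ :=
  PFun.prodLift (fun p => S p.2) (fun p => S p.1)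

/-- `Ψ_{k,ℓ} : X_ℓ × X_k → X_k`, `Ψ_{k,ℓ}(M|s, N|t) = π^k_t (g(M|s) g(N|t))`. -/
def Psi {n : ℕ} (k ℓ : ℕ) [NeZero k] [NeZero ℓ] : X n ℓ × X n k →. X n k := fun p =>
  (gProd p).bind fun A => evalProj k p.2.2 A.1

/-- The geometric R-matrix `R = (Ψ_{k,ℓ}, S ∘ Ψ_{ℓ,k} ∘ S) : X_ℓ × X_k → X_k × X_ℓ`. -/
def geomR {n ℓ k : ℕ} [NeZero ℓ] [NeZero k] : X n ℓ × X n k →. X n k × X n ℓ :=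
  PFun.prodLift (Psi k ℓ) (S.comp ((Psi ℓ k).comp S₂))

/-! ### Zariski density -/

/-- The coordinates of `(Z, s, W, t)`, with `Z` and `W` matrices of sizes `n × ℓ`, `n × k` and
`s`, `t` scalars. -/
abbrev Coord (n ℓ k : ℕ) : Type := ((Fin n × Fin ℓ) ⊕ Unit) ⊕ ((Fin n × Fin k) ⊕ Unit)

def coordVal {n ℓ k : ℕ} (Z : Matrix (Fin n) (Fin ℓ) ℂ) (s : ℂ) (W : Matrix (Fin n) (Fin k) ℂ)
    (t : ℂ) : Coord n ℓ k → ℂ :=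
  Sum.elim (Sum.elim (fun a => Z a.1 a.2) fun _ => s) (Sum.elim (fun a => W a.1 a.2) fun _ => t)

/-- `D` contains a nonempty (hence dense) Zariski-open subset of the irreducible variety
`X_ℓ × X_k`: some nonzero polynomial `F` in the entries of matrix representatives `Z` of `M`
and `W` of `N` and in `s`, `t` has the property that `(M|s, N|t)` lies in `D` as soon as
`F(Z, s, W, t) ≠ 0`. -/
def ContainsDenseOpen {n ℓ k : ℕ} (D : Set (X n ℓ × X n k)) : Prop :=
  ∃ F : MvPolynomial (Coord n ℓ k) ℂ, F ≠ 0 ∧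
    ∀ (M : Gr ℓ n) (s : ℂˣ) (N : Gr k n) (t : ℂˣ)
      (Z : Matrix (Fin n) (Fin ℓ) ℂ) (W : Matrix (Fin n) (Fin k) ℂ),
      IsRep Z M → IsRep W N →
      MvPolynomial.eval (coordVal Z (s : ℂ) W (t : ℂ)) F ≠ 0 → ((M, s), (N, t)) ∈ D

end GeomR

end

noncomputable section

namespace GeomR

open Polynomial

/-! Put `λ = xⁿ` and identify `ℂ[λ]ⁿ` with `ℂ[x]`. Then `A = g(N|t)` has an intrinsic description
(`Realizes`): column `b` occupies the positions `b, …, b + n - k` with top coefficient `1`, and at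
`μ = (-1)^(k-1) t` all columns lie in `N`. Since `N` contains no nonzero vector vanishing on `k`
cyclically consecutive coordinates, such a matrix is unique (`Realizes.eq_of_band`). Division with
remainder by band matrices shows moreover that every polynomial vector with value in `N` at `μ` is a
combination of the columns of `A` (`Realizes.exists_mulVec`). In particular `A` degenerates only at
`λ = μ`.

Let `A = g(u)`, `B = g(v)`, with evaluation points `σ`, `τ`. At `τ` the product `A * B` has rank at
most `k`, so its columns lie in the subspace of `v'` and `A * B = B' * E` with `B' = g(v')`.
Comparing degrees and orders, `E` is a band matrix of width `n - ℓ`. If `σ ≠ τ`, then `B'` is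
invertible at `σ`, and uniqueness, applied after the flip, gives `E = g(u')` (`mul_eq_mul_of_ne`).
If `σ = τ`, ranks force `k = ℓ` and `R` is trivial on the subspaces (`mul_eq_mul_of_eq`).

For the density statement it suffices to find one point where all the cyclic minors involved are
nonzero, because these are rational functions regular there. Take subspaces spanned by eigenvectors
of the twisted cyclic shift: their `g` is a Toeplitz matrix, that is, multiplication by a polynomial
in `ℂ[x]`. Toeplitz matrices commute and are fixed by the flip, so at such points `S` is the
identity and `Ψ` is a projection. -/

/-! ### Unfolding `ℂ[λ]ⁿ` to `ℂ[x]`, with `λ = xⁿ` -/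

/-- The image of `f` under the isomorphism `ℂ[λ]ⁿ → ℂ[x]`, `λ ↦ xⁿ`, `eᵢ ↦ xⁱ`. -/
def unfold {n : ℕ} (f : Fin n → ℂ[X]) : ℂ[X] :=
  ∑ i : Fin n, Polynomial.X ^ (i : ℕ) * expand ℂ n (f i)

theorem coeff_X_pow_mul_expand {n : ℕ} (q : ℂ[X]) (i j : Fin n) (d : ℕ) :
    (Polynomial.X ^ (j : ℕ) * expand ℂ n q).coeff (i + n * d) = if j = i then q.coeff d else 0 := by
  have hn : 0 < n := i.pos
  rw [coeff_X_pow_mul', coeff_expand hn]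
  by_cases hji : j = i
  · subst hji
    simp [hn]
  · rw [if_neg hji]
    split_ifs with h1 h2
    · exfalso
      apply hji
      have h3 : (j : ℕ) ≡ i + n * d [MOD n] := (Nat.modEq_iff_dvd' h1).2 h2
      have h4 : (j : ℕ) % n = i % n := by simpa [Nat.ModEq] using h3
      rw [Nat.mod_eq_of_lt i.2, Nat.mod_eq_of_lt j.2] at h4
      exact Fin.ext h4
    · rfl
    · rfl

theorem coeff_unfold {n : ℕ} (f : Fin n → ℂ[X]) (i : Fin n) (d : ℕ) :
    (unfold f).coeff (i + n * d) = (f i).coeff d := by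
  simp [unfold, finsetSum_coeff, coeff_X_pow_mul_expand]

theorem exists_position {n : ℕ} (hn : 0 < n) (p : ℕ) : ∃ (i : Fin n) (d : ℕ), p = i + n * d :=
  ⟨⟨p % n, Nat.mod_lt _ hn⟩, p / n, (Nat.mod_add_div p n).symm⟩

theorem unfold_injective {n : ℕ} : Function.Injective (unfold (n := n)) := by
  intro f f' h
  ext i d
  rw [← coeff_unfold, ← coeff_unfold, h]

theorem unfold_sub {n : ℕ} (f f' : Fin n → ℂ[X]) : unfold (f - f') = unfold f - unfold f' := by
  simp [unfold, mul_sub]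

@[simp]
theorem unfold_zero {n : ℕ} : unfold (0 : Fin n → ℂ[X]) = 0 := by
  simp [unfold]

theorem unfold_mulVec {n : ℕ} (A : Matrix (Fin n) (Fin n) ℂ[X]) (q : Fin n → ℂ[X]) :
    unfold (A.mulVec q) = ∑ j, expand ℂ n (q j) * unfold (A.col j) := by
  simp only [unfold, Matrix.mulVec, dotProduct, map_sum, map_mul, Finset.mul_sum]
  rw [Finset.sum_comm]
  refine Finset.sum_congr rfl fun j _ => Finset.sum_congr rfl fun i _ => ?_
  simp only [Matrix.col_apply]
  ring

theorem eval_unfold {n : ℕ} (f : Fin n → ℂ[X]) (z : ℂ) :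
    (unfold f).eval z = ∑ i : Fin n, z ^ (i : ℕ) * (f i).eval (z ^ n) := by
  simp [unfold, eval_finsetSum, expand_eval]

/-! ### Band matrices -/

/-- After unfolding, column `b` of `A` is supported in the positions `b, …, b + m`, and its entry
in position `b + m` is `1`. -/
structure Band {n : ℕ} (m : ℕ) (A : Matrix (Fin n) (Fin n) ℂ[X]) : Prop where
  supp : ∀ (i b : Fin n) (d : ℕ), (A i b).coeff d ≠ 0 → (b : ℕ) ≤ i + n * d ∧ i + n * d ≤ b + m
  top : ∀ (i b : Fin n) (d : ℕ), (i : ℕ) + n * d = b + m → (A i b).coeff d = 1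

theorem band_iff_unfold {n m : ℕ} {A : Matrix (Fin n) (Fin n) ℂ[X]} :
    Band m A ↔ ∀ b : Fin n, Polynomial.X ^ (b : ℕ) ∣ unfold (A.col b) ∧
      (unfold (A.col b)).natDegree ≤ b + m ∧ (unfold (A.col b)).coeff (b + m) = 1 := by
  constructor
  · intro h b
    refine ⟨X_pow_dvd_iff.2 fun p hp => ?_, natDegree_le_iff_coeff_eq_zero.2 fun p hp => ?_, ?_⟩
    · obtain ⟨i, d, rfl⟩ := exists_position b.pos p
      rw [coeff_unfold]
      by_contra h0
      have := h.supp i b d h0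
      omega
    · obtain ⟨i, d, rfl⟩ := exists_position b.pos p
      rw [coeff_unfold]
      by_contra h0
      have := h.supp i b d h0
      omega
    · obtain ⟨i, d, hid⟩ := exists_position b.pos (b + m)
      rw [hid, coeff_unfold]
      exact h.top i b d hid.symm
  · intro h
    refine ⟨fun i b d h0 => ?_, fun i b d hid => ?_⟩
    · obtain ⟨h1, h2, -⟩ := h b
      have h0' : (unfold (A.col b)).coeff (i + n * d) ≠ 0 := by rwa [coeff_unfold]
      constructor
      · by_contra hlt
        exact h0' (X_pow_dvd_iff.1 h1 _ (by omega))
      · by_contra hlt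
        exact h0' (natDegree_le_iff_coeff_eq_zero.1 h2 _ (by omega))
    · have := (h b).2.2
      rwa [← hid, coeff_unfold] at this

theorem Band.exists_factor {n m : ℕ} {A : Matrix (Fin n) (Fin n) ℂ[X]} (h : Band m A) (b : Fin n) :
    ∃ w : ℂ[X], unfold (A.col b) = Polynomial.X ^ (b : ℕ) * w ∧ w.natDegree ≤ m ∧ w.coeff m = 1 ∧
      w.coeff 0 = (A b b).coeff 0 := by
  obtain ⟨⟨w, hw⟩, h2, h3⟩ := band_iff_unfold.1 h b
  rw [hw] at h2 h3
  have key : ∀ p, (Polynomial.X ^ (b : ℕ) * w).coeff (b + p) = w.coeff p := fun p => by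
    rw [add_comm, coeff_X_pow_mul]
  refine ⟨w, hw, natDegree_le_iff_coeff_eq_zero.2 fun p hp => ?_, ?_, ?_⟩
  · rw [← key]
    exact natDegree_le_iff_coeff_eq_zero.1 h2 _ (by omega)
  · rw [← key, h3]
  · rw [← key, ← hw]
    exact coeff_unfold _ b 0

/-- The entries of `q` occupy disjoint residue classes of positions modulo `n`. Hence bounds on the
degree or order of `unfold q` pass to each entry, without cancellation. -/
theorem coeff_part {n : ℕ} (hn : 0 < n) (q : Fin n → ℂ[X]) (j : Fin n) (p : ℕ)
    (h : (unfold q).coeff p = 0) : (Polynomial.X ^ (j : ℕ) * expand ℂ n (q j)).coeff p = 0 := by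
  obtain ⟨i, d, rfl⟩ := exists_position hn p
  rw [coeff_unfold] at h
  rw [coeff_X_pow_mul_expand]
  split_ifs with hji
  · rw [hji, h]
  · rfl

/-- Every unfolded column is `x^b` times a polynomial of degree `m` with leading coefficient `1`, so
at the top `A` acts like multiplication by `x^m`. -/
theorem Band.mulVec_top {n m : ℕ} {A : Matrix (Fin n) (Fin n) ℂ[X]} (h : Band m A) (hn : 0 < n)
    (q : Fin n → ℂ[X]) {D : ℕ} (hD : (unfold q).natDegree ≤ D) :
    (unfold (A.mulVec q)).natDegree ≤ D + m ∧
      (unfold (A.mulVec q)).coeff (D + m) = (unfold q).coeff D := by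
  choose w hw hdeg htop _ using h.exists_factor
  have hpart : ∀ j : Fin n, (Polynomial.X ^ (j : ℕ) * expand ℂ n (q j)).natDegree ≤ D := fun j =>
    natDegree_le_iff_coeff_eq_zero.2 fun p hp =>
      coeff_part hn q j p (natDegree_le_iff_coeff_eq_zero.1 hD p hp)
  have hsum : unfold (A.mulVec q) =
      ∑ j : Fin n, Polynomial.X ^ (j : ℕ) * expand ℂ n (q j) * w j := by
    rw [unfold_mulVec]
    refine Finset.sum_congr rfl fun j _ => ?_
    rw [hw]
    ring
  rw [hsum]
  refine ⟨natDegree_sum_le_of_forall_le _ _ fun j _ =>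
    natDegree_mul_le.trans (add_le_add (hpart j) (hdeg j)), ?_⟩
  rw [finsetSum_coeff, unfold, finsetSum_coeff]
  refine Finset.sum_congr rfl fun j _ => ?_
  rw [coeff_mul_add_eq_of_natDegree_le (hpart j) (hdeg j), htop, mul_one]

/-- The counterpart of `Band.mulVec_top` at the low end: there `A` acts by its diagonal constant
terms. -/
theorem Band.mulVec_bot {n m : ℕ} {A : Matrix (Fin n) (Fin n) ℂ[X]} (h : Band m A)
    (q : Fin n → ℂ[X]) (i : Fin n) (d : ℕ) (hD : Polynomial.X ^ (i + n * d : ℕ) ∣ unfold q) :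
    Polynomial.X ^ (i + n * d : ℕ) ∣ unfold (A.mulVec q) ∧
      (unfold (A.mulVec q)).coeff (i + n * d) = (q i).coeff d * (A i i).coeff 0 := by
  choose w hw _ _ hbot using h.exists_factor
  have hpart : ∀ j : Fin n,
      Polynomial.X ^ (i + n * d : ℕ) ∣ Polynomial.X ^ (j : ℕ) * expand ℂ n (q j) := fun j =>
    X_pow_dvd_iff.2 fun p hp => coeff_part i.pos q j p (X_pow_dvd_iff.1 hD p hp)
  have hsum : unfold (A.mulVec q) =
      ∑ j : Fin n, Polynomial.X ^ (j : ℕ) * expand ℂ n (q j) * w j := by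
    rw [unfold_mulVec]
    refine Finset.sum_congr rfl fun j _ => ?_
    rw [hw]
    ring
  have hcoeff : ∀ j : Fin n, (Polynomial.X ^ (j : ℕ) * expand ℂ n (q j) * w j).coeff (i + n * d)
      = if j = i then (q j).coeff d * (A j j).coeff 0 else 0 := fun j => by
    have h1 := coeff_X_pow_mul_expand (q j) i j d
    obtain ⟨r, hr⟩ := hpart j
    rw [hr] at h1 ⊢
    have h2 : ∀ u : ℂ[X], (Polynomial.X ^ (i + n * d : ℕ) * u).coeff (i + n * d) = u.coeff 0 :=
      fun u => by simpa using coeff_X_pow_mul u (i + n * d) 0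
    rw [h2] at h1
    rw [mul_assoc, h2, mul_coeff_zero, h1, hbot]
    split_ifs <;> simp
  rw [hsum]
  refine ⟨Finset.dvd_sum fun j _ => (hpart j).mul_right _, ?_⟩
  rw [finsetSum_coeff]
  simp [hcoeff]

theorem Band.natDegree_le_of_mulVec {n m : ℕ} {A : Matrix (Fin n) (Fin n) ℂ[X]} (h : Band m A)
    (hn : 0 < n) {q : Fin n → ℂ[X]} {D : ℕ} (hD : (unfold (A.mulVec q)).natDegree ≤ D + m) :
    (unfold q).natDegree ≤ D := by
  by_contra hlt
  have h1 := (h.mulVec_top hn q le_rfl).2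
  rw [natDegree_le_iff_coeff_eq_zero.1 hD _ (by omega)] at h1
  have h2 : unfold q = 0 := leadingCoeff_eq_zero.1 h1.symm
  simp [h2] at hlt

/-- The lowest coefficient of `q` cannot be lost, as it is multiplied by a nonzero diagonal constant
term. -/
theorem Band.dvd_of_mulVec {n m : ℕ} {A : Matrix (Fin n) (Fin n) ℂ[X]} (h : Band m A)
    (hn : 0 < n) (hdiag : ∀ i, (A i i).coeff 0 ≠ 0) {q : Fin n → ℂ[X]} {r : ℕ}
    (hr : Polynomial.X ^ r ∣ unfold (A.mulVec q)) : Polynomial.X ^ r ∣ unfold q := by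
  induction r with
  | zero => simp
  | succ r ih =>
    obtain ⟨i, d, rfl⟩ := exists_position hn r
    have h1 := ih ((pow_dvd_pow Polynomial.X (Nat.le_succ _)).trans hr)
    have h2 := (h.mulVec_bot q i d h1).2
    rw [X_pow_dvd_iff.1 hr _ (Nat.lt_succ_self _)] at h2
    have h3 : (q i).coeff d = 0 := (mul_eq_zero.1 h2.symm).resolve_right (hdiag i)
    refine X_pow_dvd_iff.2 fun p hp => ?_
    rcases Nat.lt_succ_iff_lt_or_eq.1 hp with hp | rfl
    · exact X_pow_dvd_iff.1 h1 p hp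
    · rw [coeff_unfold, h3]

theorem Band.dvd_mulVec {n m : ℕ} {A : Matrix (Fin n) (Fin n) ℂ[X]} (h : Band m A)
    (hn : 0 < n) {q : Fin n → ℂ[X]} {r : ℕ} (hr : Polynomial.X ^ r ∣ unfold q) :
    Polynomial.X ^ r ∣ unfold (A.mulVec q) := by
  obtain ⟨i, d, rfl⟩ := exists_position hn r
  exact (h.mulVec_bot q i d hr).1

theorem Band.mul {n m m' : ℕ} {A B : Matrix (Fin n) (Fin n) ℂ[X]} (hA : Band m A)
    (hB : Band m' B) : Band (m' + m) (A * B) := by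
  refine band_iff_unfold.2 fun b => ?_
  have hcol : (A * B).col b = A.mulVec (B.col b) := rfl
  obtain ⟨h1, h2, h3⟩ := band_iff_unfold.1 hB b
  have := hA.mulVec_top b.pos _ h2
  rw [hcol, ← add_assoc]
  exact ⟨hA.dvd_mulVec b.pos h1, this.1, this.2.trans h3⟩

/-- Band matrices shift degrees exactly and preserve orders, so a band factor can be cancelled. This
is how the second factor of a refactorization is seen to have the right width. -/
theorem Band.of_mul_left {n m m' : ℕ} {A B : Matrix (Fin n) (Fin n) ℂ[X]} (hA : Band m A)
    (hdiag : ∀ i, (A i i).coeff 0 ≠ 0) (hAB : Band (m' + m) (A * B)) : Band m' B := by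
  refine band_iff_unfold.2 fun b => ?_
  have hcol : (A * B).col b = A.mulVec (B.col b) := rfl
  obtain ⟨h1, h2, h3⟩ := band_iff_unfold.1 hAB b
  rw [hcol] at h1 h2 h3
  rw [← add_assoc] at h2 h3
  have h4 := hA.natDegree_le_of_mulVec b.pos h2
  exact ⟨hA.dvd_of_mulVec b.pos hdiag h1, h4, (hA.mulVec_top b.pos _ h4).2.symm.trans h3⟩

/-- Division with remainder by a band matrix. -/
theorem Band.exists_div {n m : ℕ} {A : Matrix (Fin n) (Fin n) ℂ[X]} (h : Band m A) (hn : 0 < n)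
    (f : Fin n → ℂ[X]) : ∃ q : Fin n → ℂ[X], (unfold (f - A.mulVec q)).degree < m := by
  induction hD : (unfold f).natDegree using Nat.strong_induction_on generalizing f with
  | _ D ih =>
  by_cases hm : (unfold f).degree < m
  · exact ⟨0, by simpa using hm⟩
  have hf : unfold f ≠ 0 := by
    rintro h0
    simp [h0] at hm
  have hmD : m ≤ D := by
    rw [← hD]
    rw [degree_eq_natDegree hf, not_lt] at hm
    exact_mod_cast hm
  -- The vector `c λ^d e_i` unfolds to `c x^(D-m)`; multiplied by `A`, it matches the leading term
  -- of `f`.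
  obtain ⟨i, d, hid⟩ := exists_position hn (D - m)
  set c := (unfold f).leadingCoeff with hc
  let q₀ : Fin n → ℂ[X] := Pi.single i (C c * Polynomial.X ^ d)
  have hq₀ : unfold q₀ = C c * Polynomial.X ^ (D - m) := by
    rw [unfold, Finset.sum_eq_single i]
    · simp only [q₀, Pi.single_eq_same, map_mul, expand_C, map_pow, expand_X, hid, pow_add,
        pow_mul]
      ring
    · intro j _ hj
      simp [q₀, hj]
    · simp
  have hq₀D : (unfold q₀).natDegree ≤ D - m := by
    rw [hq₀]
    exact natDegree_C_mul_X_pow_le _ _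
  obtain ⟨h1, h2⟩ := h.mulVec_top hn q₀ hq₀D
  rw [Nat.sub_add_cancel hmD] at h1 h2
  have h3 : (unfold (A.mulVec q₀)).coeff D = c := by
    rw [h2, hq₀]
    simp
  by_cases hlt : (unfold (f - A.mulVec q₀)).natDegree < D
  · obtain ⟨q, hq⟩ := ih _ hlt _ rfl
    refine ⟨q₀ + q, ?_⟩
    rwa [Matrix.mulVec_add, ← sub_sub]
  -- The coefficient at `D` cancels, so the degree can only fail to drop when the difference is zero
  -- (`natDegree 0 = 0`, with `D = 0`).
  · have h4 : (unfold (f - A.mulVec q₀)).natDegree ≤ D := by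
      rw [unfold_sub]
      exact (natDegree_sub_le _ _).trans (max_le hD.le h1)
    have h5 : (unfold (f - A.mulVec q₀)).natDegree = D := by omega
    have h6 : (unfold (f - A.mulVec q₀)).coeff D = 0 := by
      rw [unfold_sub, coeff_sub, h3, hc, leadingCoeff, hD, sub_self]
    rw [← h5] at h6
    have h7 : unfold (f - A.mulVec q₀) = 0 := leadingCoeff_eq_zero.1 h6
    refine ⟨q₀, ?_⟩
    rw [h7, degree_zero]
    exact WithBot.bot_lt_coe m

/-! ### The flip map -/

theorem fl_fl {n : ℕ} {α : Type*} (A : Matrix (Fin n) (Fin n) α) : fl (fl A) = A := by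
  ext i j
  simp [fl]

theorem fl_mul {n : ℕ} {α : Type*} [CommRing α] (A B : Matrix (Fin n) (Fin n) α) :
    fl (A * B) = fl B * fl A := by
  ext i j
  simp only [fl, Matrix.of_apply, Matrix.mul_apply]
  rw [← Equiv.sum_comp Fin.revPerm]
  exact Finset.sum_congr rfl fun l _ => mul_comm _ _

theorem fl_map {n : ℕ} {α β : Type*} (f : α → β) (A : Matrix (Fin n) (Fin n) α) :
    fl (A.map f) = (fl A).map f := rfl

theorem rank_fl {n : ℕ} (A : Matrix (Fin n) (Fin n) ℂ) : (fl A).rank = A.rank := by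
  have : fl A = A.transpose.submatrix Fin.revPerm Fin.revPerm := rfl
  rw [this, Matrix.rank_submatrix, Matrix.rank_transpose]

/-- The band condition involves only the offset `i + n * d - b`, which reflection in the
anti-diagonal preserves. -/
theorem Band.fl {n m : ℕ} {A : Matrix (Fin n) (Fin n) ℂ[X]} (h : Band m A) :
    Band m (GeomR.fl A) := by
  refine ⟨fun i b d h0 => ?_, fun i b d hid => ?_⟩
  · have h1 := h.supp b.rev i.rev d h0
    simp only [Fin.val_rev] at h1
    omega
  · refine h.top b.rev i.rev d ?_
    simp only [Fin.val_rev]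
    omega

theorem map_eval_mul {n : ℕ} (A B : Matrix (Fin n) (Fin n) ℂ[X]) (z : ℂ) :
    (A * B).map (eval z) = A.map (eval z) * B.map (eval z) :=
  Matrix.map_mul (f := evalRingHom z)

theorem col_mul_mem {n : ℕ} {N : Submodule ℂ (Fin n → ℂ)} {A : Matrix (Fin n) (Fin n) ℂ}
    (h : ∀ b, A.col b ∈ N) (v : Fin n → ℂ) : A.mulVec v ∈ N := by
  have : A.mulVec v = ∑ j, v j • A.col j := by
    ext i
    simp [Matrix.mulVec, dotProduct, mul_comm]
  rw [this]
  exact N.sum_mem fun j _ => N.smul_mem _ (h j)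

theorem map_eval_mulVec {n : ℕ} (A : Matrix (Fin n) (Fin n) ℂ[X]) (q : Fin n → ℂ[X]) (z : ℂ) :
    (fun i => (A.mulVec q i).eval z) = (A.map (eval z)).mulVec fun i => (q i).eval z := by
  ext i
  simp [Matrix.mulVec, dotProduct, eval_finsetSum]

/-! ### Residues of intervals -/

/-- Within these bounds the only candidates congruent to `a + 1` are `a + 1` and `a + 1 - n`, which
turns cyclic intervals into linear arithmetic. -/
theorem mem_residues_Icc {n : ℕ} {x y : ℤ} (hx : 1 - n ≤ x) (hy : y ≤ n) (a : Fin n) :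
    a ∈ residues n (Finset.Icc x y) ↔
      (x ≤ a + 1 ∧ (a : ℤ) + 1 ≤ y) ∨ (x ≤ a + 1 - n ∧ (a : ℤ) + 1 - n ≤ y) := by
  have ha := a.2
  simp only [residues, Finset.mem_filter, Finset.mem_univ, true_and, Finset.mem_Icc]
  constructor
  · rintro ⟨m, ⟨h1, h2⟩, h3⟩
    obtain ⟨c, hc⟩ := h3.dvd
    have h4 : c < 2 := by
      by_contra h
      have : (n : ℤ) * 2 ≤ n * c := mul_le_mul_of_nonneg_left (by omega) (by omega)
      omega
    have h5 : -1 < c := by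
      by_contra h
      have : (n : ℤ) * c ≤ n * (-1) := mul_le_mul_of_nonneg_left (by omega) (by omega)
      omega
    have h6 : c = 0 ∨ c = 1 := by omega
    rcases h6 with rfl | rfl
    · left; omega
    · right; omega
  · rintro (h | h)
    · exact ⟨a + 1, h, rfl⟩
    · exact ⟨a + 1 - n, h, Int.modEq_iff_dvd.2 ⟨1, by ring⟩⟩

theorem card_residues_Icc {n : ℕ} {x y : ℤ} (c : ℕ) (hc : c ≤ n) (hxy : y + 1 = x + c) :
    (residues n (Finset.Icc x y)).card = c := by
  rcases Nat.eq_zero_or_pos n with rfl | hn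
  · have : c = 0 := by omega
    subst this
    exact Finset.card_eq_zero.2 (Subsingleton.elim _ _)
  have hn' : (0 : ℤ) < n := by exact_mod_cast hn
  let r : ℤ → Fin n := fun m => ⟨((m - 1) % n).toNat, by
    have h1 := Int.emod_nonneg (m - 1) hn'.ne'
    have h2 := Int.emod_lt_of_pos (m - 1) hn'
    omega⟩
  have hr : ∀ m, ((r m : ℕ) : ℤ) = (m - 1) % n := fun m =>
    Int.toNat_of_nonneg (Int.emod_nonneg (m - 1) hn'.ne')
  have himage : residues n (Finset.Icc x y) = (Finset.Icc x y).image r := by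
    ext a
    simp only [residues, Finset.mem_filter, Finset.mem_univ, true_and, Finset.mem_image]
    refine exists_congr fun m => and_congr_right fun _ => ?_
    have ha : (a : ℤ) < n := by exact_mod_cast a.2
    have h1 : (a : ℤ) % n = a := Int.emod_eq_of_lt (by omega) ha
    have h2 : m ≡ a + 1 [ZMOD n] ↔ m - 1 ≡ a [ZMOD n] := by
      constructor
      · intro h; simpa using h.sub_right 1
      · intro h; simpa using h.add_right 1
    rw [h2, Int.ModEq, h1, ← hr, Fin.ext_iff]
    exact_mod_cast Iff.rfl
  rw [himage, Finset.card_image_of_injOn, Int.card_Icc]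
  · omega
  · intro m hm m' hm' h
    simp only [Finset.coe_Icc, Set.mem_Icc] at hm hm'
    have h1 : (m - 1) % n = (m' - 1) % n := by rw [← hr, ← hr, h]
    have h2 : m - 1 ≡ m' - 1 [ZMOD n] := h1
    obtain ⟨e, he⟩ := h2.dvd
    have h4 : e < 1 := by
      by_contra h
      have : (n : ℤ) * 1 ≤ n * e := mul_le_mul_of_nonneg_left (by omega) (by omega)
      omega
    have h5 : -1 < e := by
      by_contra h
      have : (n : ℤ) * e ≤ n * (-1) := mul_le_mul_of_nonneg_left (by omega) (by omega)
      omega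
    have h6 : e = 0 := by omega
    subst h6
    omega

theorem residues_insert {n : ℕ} (I : Finset ℤ) (a : Fin n) :
    residues n (insert ((a : ℤ) + 1) I) = insert a (residues n I) := by
  ext c
  simp only [residues, Finset.mem_filter, Finset.mem_univ, true_and, Finset.mem_insert,
    exists_eq_or_imp]
  refine or_congr_left ⟨fun h => ?_, fun h => by rw [h]⟩
  have h1 : (a : ℤ) ≡ c [ZMOD n] := Int.ModEq.add_right_cancel' 1 h
  have h2 := Int.natCast_modEq_iff.1 h1
  rw [Nat.ModEq, Nat.mod_eq_of_lt a.2, Nat.mod_eq_of_lt c.2] at h2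
  exact Fin.ext h2.symm

/-! ### Subspaces in general position with respect to cyclic intervals -/

/-- No nonzero vector of `N` vanishes on `k` cyclically consecutive coordinates. -/
def CyclicGeneric {n : ℕ} (k : ℕ) (N : Submodule ℂ (Fin n → ℂ)) : Prop :=
  ∀ j : ℤ, 1 ≤ j → j ≤ n → ∀ v ∈ N,
    (∀ a ∈ residues n (Finset.Icc (j - k) (j - 1)), v a = 0) → v = 0

theorem IsRep.mem_iff {n k : ℕ} {Z : Matrix (Fin n) (Fin k) ℂ} {N : Gr k n} (h : IsRep Z N)
    {v : Fin n → ℂ} : v ∈ N.1 ↔ ∃ x, Z.mulVec x = v := by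
  rw [← h, ← Matrix.range_mulVecLin]
  rfl

theorem IsRep.linearIndependent {n k : ℕ} {Z : Matrix (Fin n) (Fin k) ℂ} {N : Gr k n}
    (h : IsRep Z N) : LinearIndependent ℂ Z.col := by
  rw [linearIndependent_iff_card_eq_finrank_span, Set.finrank]
  have : Submodule.span ℂ (Set.range Z.col) = N.1 := h
  rw [this, N.2, Fintype.card_fin]

/-- A maximal minor of `Z` is nonzero exactly when restriction of `N` to the chosen rows is
injective. -/
theorem cyclicNonzero_iff {n k : ℕ} (hk : k ≤ n) {Z : Matrix (Fin n) (Fin k) ℂ} {N : Gr k n}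
    (h : IsRep Z N) : CyclicNonzero Z ↔ CyclicGeneric k N.1 := by
  unfold CyclicNonzero CyclicGeneric plucker minor
  refine forall_congr' fun j => forall_congr' fun h1 => forall_congr' fun h2 => ?_
  have hcard : (residues n (Finset.Icc (j - k) (j - 1))).card = k :=
    card_residues_Icc k hk (by ring)
  rw [dif_pos hcard, ne_eq, ← Matrix.exists_mulVec_eq_zero_iff]
  push Not
  constructor
  · intro hdet v hv hva
    obtain ⟨x, rfl⟩ := h.mem_iff.1 hv
    by_contra hne
    refine hdet x (fun hx => hne (by rw [hx, Matrix.mulVec_zero])) ?_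
    ext a
    exact hva _ (Finset.orderEmbOfFin_mem _ hcard a)
  · intro hgen x hx hzero
    refine hx (Matrix.mulVec_injective_iff.2 h.linearIndependent ?_)
    rw [Matrix.mulVec_zero]
    refine hgen _ (h.mem_iff.2 ⟨x, rfl⟩) fun a ha => ?_
    have : a ∈ Set.range ((residues n (Finset.Icc (j - k) (j - 1))).orderEmbOfFin hcard) := by
      rw [Finset.range_orderEmbOfFin]
      exact ha
    obtain ⟨c, rfl⟩ := this
    exact congrFun hzero c

/-- The support of `f` lies in `n - k` consecutive positions, so the value of `f` at `μ` vanishes on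
the other `k` cyclically consecutive coordinates and is zero by genericity. As the window is shorter
than a period or equal to one, each entry of `f` is a single monomial and no cancellation occurs at
`μ ≠ 0`. -/
theorem CyclicGeneric.eq_zero {n k : ℕ} (hk : k ≤ n) {N : Submodule ℂ (Fin n → ℂ)}
    (hN : CyclicGeneric k N) {μ : ℂ} (hμ : μ ≠ 0) {f : Fin n → ℂ[X]} (b : Fin n)
    (hb : Polynomial.X ^ (b : ℕ) ∣ unfold f) (hdeg : (unfold f).degree < (b + (n - k) : ℕ))
    (hf : (fun i => (f i).eval μ) ∈ N) : f = 0 := by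
  have hsupp : ∀ (i : Fin n) (d : ℕ), (f i).coeff d ≠ 0 →
      (b : ℕ) ≤ i + n * d ∧ i + n * d < b + (n - k) := fun i d h => by
    rw [← coeff_unfold] at h
    refine ⟨?_, ?_⟩
    · by_contra hlt
      exact h (X_pow_dvd_iff.1 hb _ (by omega))
    · by_contra hlt
      exact h (coeff_eq_zero_of_degree_lt (hdeg.trans_le (by exact_mod_cast (not_lt.1 hlt))))
  have hb2 := b.2
  -- In zero-based numbering the rows for `j = b + 1` are `b - k, …, b - 1` modulo `n`, the
  -- complement of the window `b, …, b + n - k - 1`.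
  have heval := hN (b + 1) (by omega) (by omega) _ hf fun a ha => by
    rw [mem_residues_Icc (by omega) (by omega)] at ha
    have ha2 := a.2
    have : f a = 0 := by
      ext d
      by_contra h
      have h1 := hsupp a d h
      have h2 : d < 2 := by
        by_contra h2
        have : n * 2 ≤ n * d := Nat.mul_le_mul_left n (by omega)
        omega
      interval_cases d <;> omega
    simp [this]
  ext1 i
  by_contra h
  set e := (f i).natDegree with he
  have hlead : (f i).coeff e ≠ 0 := leadingCoeff_ne_zero.2 h
  have hmono : f i = monomial e ((f i).coeff e) := by
    ext d
    rw [coeff_monomial]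
    split_ifs with hed
    · rw [hed]
    · by_contra h1
      have h2 := hsupp i d h1
      have h3 := hsupp i e hlead
      rcases lt_or_gt_of_ne hed with h4 | h4
      · have : n * (e + 1) ≤ n * d := Nat.mul_le_mul_left n h4
        rw [mul_add] at this
        omega
      · have : n * (d + 1) ≤ n * e := Nat.mul_le_mul_left n h4
        rw [mul_add] at this
        omega
  have h1 := congrFun heval i
  simp only [Pi.zero_apply] at h1
  rw [hmono, eval_monomial] at h1
  exact mul_ne_zero hlead (pow_ne_zero _ hμ) h1

/-! ### Columns -/

theorem cols_mem_of_rank_le {n k : ℕ} {A : Matrix (Fin n) (Fin n) ℂ} (hA : A.rank ≤ k)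
    (h : Module.finrank ℂ (firstCols k A) = k) (b : Fin n) : A.col b ∈ firstCols k A := by
  have hle : firstCols k A ≤ Submodule.span ℂ (Set.range A.col) :=
    Submodule.span_mono (Set.image_subset_range _ _)
  rw [Matrix.rank_eq_finrank_span_cols] at hA
  rw [Submodule.eq_of_le_of_finrank_le hle (hA.trans h.ge)]
  exact Submodule.subset_span ⟨b, rfl⟩

theorem rank_le_of_cols_mem {n : ℕ} {A : Matrix (Fin n) (Fin n) ℂ}
    {N : Submodule ℂ (Fin n → ℂ)} (h : ∀ b, A.col b ∈ N) : A.rank ≤ Module.finrank ℂ N := by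
  rw [Matrix.rank_eq_finrank_span_cols]
  exact Submodule.finrank_mono (Submodule.span_le.2 (by rintro _ ⟨b, rfl⟩; exact h b))

theorem firstCols_le {n k : ℕ} {A : Matrix (Fin n) (Fin n) ℂ}
    {N : Submodule ℂ (Fin n → ℂ)} (h : ∀ b, A.col b ∈ N) : firstCols k A ≤ N :=
  Submodule.span_le.2 (by rintro _ ⟨b, -, rfl⟩; exact h b)

theorem firstCols_le_rank {n k : ℕ} (A : Matrix (Fin n) (Fin n) ℂ) :
    Module.finrank ℂ (firstCols k A) ≤ A.rank := by
  rw [Matrix.rank_eq_finrank_span_cols]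
  exact Submodule.finrank_mono (firstCols_le fun b => Submodule.subset_span ⟨b, rfl⟩)

theorem firstCols_eq_span {n k : ℕ} (hk : k ≤ n) (A : Matrix (Fin n) (Fin n) ℂ) :
    firstCols k A = Submodule.span ℂ (Set.range (A.submatrix id (Fin.castLE hk)).col) := by
  unfold firstCols
  congr 1
  ext v
  constructor
  · rintro ⟨j, hj, rfl⟩
    exact ⟨⟨j, hj⟩, rfl⟩
  · rintro ⟨j, rfl⟩
    exact ⟨Fin.castLE hk j, j.2, rfl⟩

/-- The band shape makes the last `k` rows of these columns unitriangular, whatever the value of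
`λ`. -/
theorem Band.finrank_firstCols {n k : ℕ} (hk : k ≤ n) {A : Matrix (Fin n) (Fin n) ℂ[X]}
    (h : Band (n - k) A) (z : ℂ) :
    Module.finrank ℂ (firstCols k (A.map (eval z))) = k := by
  rw [firstCols_eq_span hk, finrank_span_eq_card, Fintype.card_fin]
  let r : Fin k → Fin n := fun a => ⟨a + (n - k), by omega⟩
  have hent : ∀ a b : Fin k, b ≤ a → A (r a) (Fin.castLE hk b) = if a = b then 1 else 0 := by
    intro a b hab
    have hab' : (b : ℕ) ≤ a := hab
    ext d
    split_ifs with heq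
    · subst heq
      rcases Nat.eq_zero_or_pos d with rfl | hd
      · simpa using h.top (r a) (Fin.castLE hk a) 0 (by simp [r])
      · rw [coeff_one, if_neg hd.ne']
        by_contra h0
        have h1 := (h.supp _ _ _ h0).2
        have h2 : n * 1 ≤ n * d := Nat.mul_le_mul_left n hd
        have h3 := a.2
        simp only [r, Fin.val_castLE] at h1
        omega
    · rw [coeff_zero]
      by_contra h0
      have h1 := (h.supp _ _ _ h0).2
      have h2 : (b : ℕ) ≠ a := fun h => heq (Fin.ext h.symm)
      simp only [r, Fin.val_castLE] at h1
      omega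
  have hdet : (((A.map (eval z)).submatrix id (Fin.castLE hk)).submatrix r id).det = 1 := by
    rw [Matrix.det_of_isUpperTriangular]
    · refine Finset.prod_eq_one fun a _ => ?_
      simp [hent a a le_rfl]
    · intro a b hab
      have hab' : b < a := hab
      simp [hent a b hab'.le, hab'.ne']
  have hli := Matrix.linearIndependent_cols_of_det_ne_zero (by rw [hdet]; exact one_ne_zero)
  exact LinearIndependent.of_comp (LinearMap.funLeft ℂ ℂ r) hli

/-! ### Matrices realizing a point of `X_k` -/

/-- `A` is a band matrix of width `n - k` with columns in `N` at `λ = μ`, for a cyclically generic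
`N`. There is at most one such matrix, see `Realizes.unique`. -/
structure Realizes {n : ℕ} (k : ℕ) (μ : ℂ) (N : Submodule ℂ (Fin n → ℂ))
    (A : Matrix (Fin n) (Fin n) ℂ[X]) : Prop where
  generic : CyclicGeneric k N
  band : Band (n - k) A
  col_mem : ∀ b, (A.map (eval μ)).col b ∈ N
  diag : ∀ i, (A i i).coeff 0 ≠ 0

/-- In the difference of two corresponding columns the top coefficients `1` cancel. What remains
lies in a window of length `n - k` and takes a value in `N`, so it vanishes. -/
theorem Realizes.eq_of_band {n k : ℕ} (hk : k ≤ n) {μ : ℂ} (hμ : μ ≠ 0)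
    {N : Submodule ℂ (Fin n → ℂ)} {A A' : Matrix (Fin n) (Fin n) ℂ[X]} (h : Realizes k μ N A)
    (hband : Band (n - k) A') (hcol : ∀ b, (A'.map (eval μ)).col b ∈ N) : A = A' := by
  apply Matrix.ext_col
  intro b
  rw [← sub_eq_zero]
  obtain ⟨h1, h2, h3⟩ := band_iff_unfold.1 h.band b
  obtain ⟨h1', h2', h3'⟩ := band_iff_unfold.1 hband b
  refine h.generic.eq_zero hk hμ b ?_ ?_ ?_
  · rw [unfold_sub]
    exact dvd_sub h1 h1'
  · rw [unfold_sub, degree_lt_iff_coeff_zero]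
    intro p hp
    rw [coeff_sub]
    rcases hp.eq_or_lt with rfl | hlt
    · rw [h3, h3', sub_self]
    · rw [natDegree_le_iff_coeff_eq_zero.1 h2 p hlt, natDegree_le_iff_coeff_eq_zero.1 h2' p hlt,
        sub_self]
  · convert N.sub_mem (h.col_mem b) (hcol b) using 1
    ext i
    simp

/-- The remainder of `f` on division by `A` has degree below `n - k` and takes a value in `N` at
`μ`, so `CyclicGeneric.eq_zero` kills it. -/
theorem Realizes.exists_mulVec {n k : ℕ} (hk : k ≤ n) (hn : 0 < n) {μ : ℂ} (hμ : μ ≠ 0)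
    {N : Submodule ℂ (Fin n → ℂ)} {A : Matrix (Fin n) (Fin n) ℂ[X]} (h : Realizes k μ N A)
    {f : Fin n → ℂ[X]} (hf : (fun i => (f i).eval μ) ∈ N) : ∃ q, A.mulVec q = f := by
  obtain ⟨q, hq⟩ := h.band.exists_div hn f
  refine ⟨q, (sub_eq_zero.1
    (h.generic.eq_zero hk hμ ⟨0, hn⟩ (by simp) (by simpa using hq) ?_)).symm⟩
  convert N.sub_mem hf (col_mul_mem h.col_mem fun i => (q i).eval μ) using 1
  rw [← map_eval_mulVec]
  ext i
  simp

theorem Realizes.exists_mul {n k : ℕ} (hk : k ≤ n) {μ : ℂ} (hμ : μ ≠ 0)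
    {N : Submodule ℂ (Fin n → ℂ)} {A C : Matrix (Fin n) (Fin n) ℂ[X]} (h : Realizes k μ N A)
    (hC : ∀ b, (C.map (eval μ)).col b ∈ N) : ∃ Q, A * Q = C := by
  have : ∀ b, ∃ q, A.mulVec q = C.col b := fun b => h.exists_mulVec hk b.pos hμ (hC b)
  choose q hq using this
  refine ⟨Matrix.of fun i b => q b i, ?_⟩
  ext1 i b
  exact congrFun (hq b) i

/-- The matrix `(λ - μ) • 1` vanishes at `μ`, hence is divisible by `A`; away from `μ` the quotient
inverts `A` up to a scalar. -/
theorem Realizes.isUnit_eval {n k : ℕ} (hk : k ≤ n) {μ : ℂ} (hμ : μ ≠ 0)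
    {N : Submodule ℂ (Fin n → ℂ)} {A : Matrix (Fin n) (Fin n) ℂ[X]} (h : Realizes k μ N A)
    {z : ℂ} (hz : z ≠ μ) : IsUnit (A.map (eval z)) := by
  obtain ⟨Q, hQ⟩ := h.exists_mul hk hμ
    (C := (Polynomial.X - C μ : ℂ[X]) • (1 : Matrix (Fin n) (Fin n) ℂ[X])) (fun b => by
      convert N.zero_mem
      ext i
      by_cases hib : i = b <;> simp [hib])
  have h1 := congrArg (fun M => M.map (eval z)) hQ
  simp only [map_eval_mul] at h1
  have h2 : A.map (eval z) * ((z - μ)⁻¹ • Q.map (eval z)) = 1 := by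
    rw [Matrix.mul_smul, h1]
    ext i j
    have : z - μ ≠ 0 := sub_ne_zero.2 hz
    by_cases hij : i = j
    · subst hij
      simp [this]
    · simp [Matrix.one_apply_ne hij]
  exact IsUnit.of_mul_eq_one _ h2

theorem Realizes.rank_le {n k : ℕ} {μ : ℂ} {N : Submodule ℂ (Fin n → ℂ)}
    (hN : Module.finrank ℂ N = k) {A : Matrix (Fin n) (Fin n) ℂ[X]} (h : Realizes k μ N A) :
    (A.map (eval μ)).rank ≤ k :=
  (rank_le_of_cols_mem h.col_mem).trans hN.le

theorem Realizes.fl {n k : ℕ} (hk : k ≤ n) {μ : ℂ} {N : Submodule ℂ (Fin n → ℂ)}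
    (hN : Module.finrank ℂ N = k) {A : Matrix (Fin n) (Fin n) ℂ[X]} (h : Realizes k μ N A)
    (hgen : CyclicGeneric k (firstCols k ((GeomR.fl A).map (eval μ)))) :
    Realizes k μ (firstCols k ((GeomR.fl A).map (eval μ))) (GeomR.fl A) where
  generic := hgen
  band := h.band.fl
  col_mem := cols_mem_of_rank_le (by rw [← fl_map, rank_fl]; exact h.rank_le hN)
    (h.band.fl.finrank_firstCols hk μ)
  diag i := h.diag i.rev

/-! ### The matrix `g` realizes its argument -/

/-- Laplace expansion of a maximal minor along the row `i`, in terms of the position of `i` relative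
to the other rows. -/
theorem exists_minor_insert {n k : ℕ} (Z : Matrix (Fin n) (Fin k) ℂ) (R : Finset (Fin n))
    (hR : R.card + 1 = k) : ∃ m : Fin k → ℂ, (∀ i ∈ R, Z.mulVec m i = 0) ∧ ∀ i,
      minor Z (insert i R) = (-1) ^ (R.filter (· < i)).card * Z.mulVec m i := by
  subst hR
  let r := R.orderEmbOfFin rfl
  let m : Fin (R.card + 1) → ℂ := fun a => (-1) ^ (a : ℕ) * (Z.submatrix r a.succAbove).det
  have hm : ∀ i ∈ R, Z.mulVec m i = 0 := by
    intro i hi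
    obtain ⟨c, hc⟩ : i ∈ Set.range r := by
      rw [Finset.range_orderEmbOfFin]
      exact hi
    -- For `i ∈ R` the expansion computes a determinant with a repeated row.
    let e : Fin (R.card + 1) → Fin n := Fin.cons i r
    have hdet : (Z.submatrix e id).det = 0 :=
      Matrix.det_zero_of_row_eq (i := 0) (j := c.succ) (Fin.succ_ne_zero c).symm (by
        ext a
        simp [e, hc])
    rw [Matrix.det_succ_row_zero] at hdet
    rw [← hdet, Matrix.mulVec, dotProduct]
    refine Finset.sum_congr rfl fun a _ => ?_
    have h1 : (Z.submatrix e id).submatrix Fin.succ a.succAbove = Z.submatrix r a.succAbove := rfl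
    rw [h1]
    simp only [m, e, Matrix.submatrix_apply, Fin.cons_zero, id]
    ring
  refine ⟨m, hm, fun i => ?_⟩
  by_cases hi : i ∈ R
  · rw [Finset.insert_eq_of_mem hi, hm i hi, mul_zero]
    -- Here `insert i R = R` has only `k - 1` elements, so the minor is `0` by convention.
    exact dif_neg (by omega)
  have hcard : (insert i R).card = R.card + 1 := Finset.card_insert_of_notMem hi
  rw [minor, dif_pos hcard]
  set e := (insert i R).orderEmbOfFin hcard with he
  obtain ⟨p, hp⟩ : i ∈ Set.range e := by
    rw [he, Finset.range_orderEmbOfFin]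
    simp
  have hmem : ∀ c, e c ∈ insert i R := Finset.orderEmbOfFin_mem _ hcard
  have hr : (fun c => e (p.succAbove c)) = r := by
    refine Finset.orderEmbOfFin_unique rfl (fun c => ?_)
      (e.strictMono.comp (Fin.strictMono_succAbove p))
    refine (Finset.mem_insert.1 (hmem (p.succAbove c))).resolve_left fun h => ?_
    rw [← hp] at h
    exact Fin.succAbove_ne p c (e.injective h)
  have hfilter : R.filter (· < i) = (Finset.Iio p).image e := by
    ext x
    simp only [Finset.mem_filter, Finset.mem_image, Finset.mem_Iio]
    constructor
    · rintro ⟨hx, hxi⟩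
      obtain ⟨c, rfl⟩ : x ∈ Set.range e := by
        rw [he, Finset.range_orderEmbOfFin]
        exact Finset.mem_coe.2 (Finset.mem_insert_of_mem hx)
      rw [← hp] at hxi
      exact ⟨c, e.lt_iff_lt.1 hxi, rfl⟩
    · rintro ⟨c, hc, rfl⟩
      have h1 : e c < i := by
        rw [← hp]
        exact e.lt_iff_lt.2 hc
      exact ⟨(Finset.mem_insert.1 (hmem c)).resolve_left h1.ne, h1⟩
  rw [hfilter, Finset.card_image_of_injective _ e.injective, Fin.card_Iio, Matrix.det_succ_row _ p,
    Matrix.mulVec, dotProduct, Finset.mul_sum]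
  refine Finset.sum_congr rfl fun a _ => ?_
  have h1 : (Z.submatrix e id).submatrix p.succAbove a.succAbove = Z.submatrix r a.succAbove := by
    rw [← hr]
    rfl
  rw [h1, Matrix.submatrix_apply, hp, pow_add, id]
  ring

/-- The rows `[j-k+1, j-1]`, for `j = b + 1`. -/
theorem mem_residues_pred {n k : ℕ} (hk0 : 0 < k) (hk : k ≤ n) (a b : Fin n) :
    a ∈ residues n (Finset.Icc ((b : ℤ) + 1 - k + 1) ((b : ℤ) + 1 - 1)) ↔
      ((b : ℕ) + 1 < a + 1 + k ∧ (a : ℕ) < b) ∨ (b : ℕ) + 1 + n < a + 1 + k := by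
  have ha := a.2
  have hb := b.2
  rw [mem_residues_Icc (by omega) (by omega)]
  omega

theorem card_residues_pred {n k : ℕ} (hk0 : 0 < k) (hk : k ≤ n) (b : Fin n) :
    (residues n (Finset.Icc ((b : ℤ) + 1 - k + 1) ((b : ℤ) + 1 - 1))).card + 1 = k := by
  rw [card_residues_Icc (k - 1) (by omega) (by omega)]
  omega

theorem plucker_insert_eq_zero {n k : ℕ} (hk0 : 0 < k) (hk : k ≤ n)
    (Z : Matrix (Fin n) (Fin k) ℂ) (i b : Fin n)
    (h : ((b : ℕ) + 1 < i + 1 + k ∧ (i : ℕ) < b) ∨ (b : ℕ) + 1 + n < i + 1 + k) :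
    plucker Z (insert ((i : ℤ) + 1) (Finset.Icc ((b : ℤ) + 1 - k + 1) ((b : ℤ) + 1 - 1))) = 0 := by
  obtain ⟨m, hm0, hm⟩ := exists_minor_insert Z _ (card_residues_pred hk0 hk b)
  rw [plucker, residues_insert, hm, hm0 i ((mem_residues_pred hk0 hk i b).2 h), mul_zero]

/-- The numerator vanishes on the `k - 1` rows cyclically preceding `b`, and `c_{ij}` fixes the
power of `λ`. In position `b + n - k` the added row completes the interval `[j-k, j-1]`, so the
quotient is `1`. -/
theorem band_gMatrix {n k : ℕ} (hk0 : 0 < k) (hk : k < n) {Z : Matrix (Fin n) (Fin k) ℂ}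
    (hZ : CyclicNonzero Z) (t : ℂ) : Band (n - k) (gMatrix Z t) := by
  refine ⟨fun i b d h0 => ?_, fun i b d hid => ?_⟩
  · simp only [gMatrix, Matrix.of_apply, coeff_mul_C] at h0
    have hP : ¬(((b : ℕ) + 1 < i + 1 + k ∧ (i : ℕ) < b) ∨ (b : ℕ) + 1 + n < i + 1 + k) :=
      fun h => (div_ne_zero_iff.1 (right_ne_zero_of_mul h0)).1
      (plucker_insert_eq_zero hk0 hk.le Z i b h)
    have hc := left_ne_zero_of_mul h0
    have hi := i.2
    unfold coeffC at hc
    split_ifs at hc with h1 h2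
    · have hd : d = 0 := by
        by_contra hd
        exact hc (by rw [coeff_one, if_neg hd])
      subst hd
      omega
    · have hd : d = 0 := by
        by_contra hd
        exact hc (coeff_C_of_ne_zero hd)
      subst hd
      omega
    · have hd : d = 1 := by
        by_contra hd
        exact hc (coeff_X_of_ne_one hd)
      subst hd
      omega
  · have hi := i.2
    have hb := b.2
    have hd2 : d < 2 := by
      by_contra h2
      have : n * 2 ≤ n * d := Nat.mul_le_mul_left n (by omega)
      omega
    have hres : residues n (insert ((i : ℤ) + 1)
        (Finset.Icc ((b : ℤ) + 1 - k + 1) ((b : ℤ) + 1 - 1)))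
        = residues n (Finset.Icc ((b : ℤ) + 1 - k) ((b : ℤ) + 1 - 1)) := by
      ext a
      have ha := a.2
      rw [residues_insert, Finset.mem_insert, mem_residues_pred hk0 hk.le,
        mem_residues_Icc (by omega) (by omega), Fin.ext_iff]
      interval_cases d <;> omega
    have hone : plucker Z (insert ((i : ℤ) + 1)
        (Finset.Icc ((b : ℤ) + 1 - k + 1) ((b : ℤ) + 1 - 1)))
        / plucker Z (Finset.Icc ((b : ℤ) + 1 - k) ((b : ℤ) + 1 - 1)) = 1 := by
      rw [plucker, hres]
      exact div_self (hZ (b + 1) (by omega) (by omega))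
    simp only [gMatrix, Matrix.of_apply, hone, coeff_mul_C, mul_one]
    unfold coeffC
    interval_cases d
    · rw [if_pos (by omega), coeff_one_zero]
    · rw [if_neg (by omega), if_neg (by omega), coeff_X_one]

/-- By Laplace expansion the numerators are, up to signs, the coordinates of the vector `Z m` of `N`
that vanishes on `R`. The evaluation point is chosen so that these signs and `c_{ij}` combine into
one scalar per column. -/
theorem gMatrix_col_mem {n k : ℕ} (hk0 : 0 < k) (hk : k < n) {Z : Matrix (Fin n) (Fin k) ℂ}
    {N : Gr k n} (hZN : IsRep Z N) (t : ℂ) (b : Fin n) :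
    ((gMatrix Z t).map (eval ((-1) ^ (k - 1) * t))).col b ∈ N.1 := by
  obtain ⟨m, hm0, hm⟩ := exists_minor_insert Z _ (card_residues_pred hk0 hk.le b)
  set R := residues n (Finset.Icc ((b : ℤ) + 1 - k + 1) ((b : ℤ) + 1 - 1)) with hR
  set P := plucker Z (Finset.Icc ((b : ℤ) + 1 - k) ((b : ℤ) + 1 - 1)) with hP
  have hmem : ∀ a, a ∈ R ↔ _ := fun a => mem_residues_pred hk0 hk.le a b
  set κ : ℂ := (if (b : ℕ) < k then (-1) ^ (b : ℕ) else (-1) ^ (k - 1) * t) / P with hκ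
  have hcol : ((gMatrix Z t).map (eval ((-1) ^ (k - 1) * t))).col b = κ • Z.mulVec m := by
    ext i
    have hi := i.2
    have hb := b.2
    simp only [Matrix.col_apply, Matrix.map_apply, gMatrix, Matrix.of_apply, eval_mul, eval_C,
      Pi.smul_apply, smul_eq_mul, plucker, residues_insert, ← hR]
    rw [hm, ← plucker, ← hP]
    by_cases hiR : i ∈ R
    · rw [hm0 i hiR]
      simp
    rw [hmem] at hiR
    -- Off `R`, the rows of `R` above row `i` are the first `b` rows if `b < k`; if `k ≤ b`, they
    -- are all `k - 1` rows of `R` when `b ≤ i` (with `c = t`) and none when `i < b` (with `c = λ`).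
    have hsign : (coeffC k t ((i : ℤ) + 1) ((b : ℤ) + 1)).eval ((-1) ^ (k - 1) * t)
        * (-1) ^ (R.filter (· < i)).card
        = if (b : ℕ) < k then (-1) ^ (b : ℕ) else (-1) ^ (k - 1) * t := by
      unfold coeffC
      by_cases hbk : (b : ℕ) < k
      · have hfilter : R.filter (· < i) = Finset.Iio b := by
          ext a
          simp only [Finset.mem_filter, hmem, Finset.mem_Iio, Fin.lt_def]
          omega
        rw [hfilter, Fin.card_Iio, if_pos (by omega), if_pos hbk, eval_one, one_mul]
      · rw [if_neg (by omega), if_neg hbk]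
        by_cases hbi : (b : ℕ) ≤ i
        · have hfilter : R.filter (· < i) = R := by
            refine Finset.filter_true_of_mem fun a ha => ?_
            have h1 := (hmem a).1 ha
            have h2 := a.2
            rw [Fin.lt_def]
            omega
          have hcard : R.card = k - 1 := by
            have : R.card + 1 = k := card_residues_pred hk0 hk.le b
            omega
          rw [hfilter, hcard, if_pos (by omega), eval_C, mul_comm]
        · have hfilter : R.filter (· < i) = ∅ := by
            refine Finset.filter_false_of_mem fun a ha => ?_
            have h1 := (hmem a).1 ha
            have h2 := a.2
            rw [Fin.lt_def]
            omega
          rw [hfilter, if_neg (by omega), eval_X, Finset.card_empty, pow_zero, mul_one]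
    rw [hκ, ← hsign]
    ring
  rw [hcol]
  exact N.1.smul_mem _ (hZN.mem_iff.2 ⟨m, rfl⟩)

theorem realizes_gMatrix {n k : ℕ} [NeZero k] (hk : k < n) {Z : Matrix (Fin n) (Fin k) ℂ}
    {N : Gr k n} (hZN : IsRep Z N) (hZ : CyclicNonzero Z) (t : ℂˣ) :
    Realizes k ((-1) ^ (k - 1) * (t : ℂ)) N.1 (gMatrix Z t) where
  generic := (cyclicNonzero_iff hk.le hZN).1 hZ
  band := band_gMatrix (Nat.pos_of_neZero k) hk hZ t
  col_mem := gMatrix_col_mem (Nat.pos_of_neZero k) hk hZN t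
  diag := (gMatrix_mem Z hZ t).1

/-! ### Refactorization of a product -/

theorem rank_mul_eval_le {n m : ℕ} {A B : Matrix (Fin n) (Fin n) ℂ[X]} {z : ℂ}
    (h : (A.map (eval z)).rank ≤ m ∨ (B.map (eval z)).rank ≤ m) :
    ((A * B).map (eval z)).rank ≤ m := by
  rw [map_eval_mul]
  rcases h with h | h
  · exact (Matrix.rank_mul_le_left _ _).trans h
  · exact (Matrix.rank_mul_le_right _ _).trans h

theorem cols_mul_mem {n : ℕ} {A B : Matrix (Fin n) (Fin n) ℂ[X]} {z : ℂ}
    {N : Submodule ℂ (Fin n → ℂ)} (h : ∀ b, (A.map (eval z)).col b ∈ N) (b : Fin n) :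
    ((A * B).map (eval z)).col b ∈ N := by
  rw [map_eval_mul]
  exact col_mul_mem h _

theorem cols_mem_of_mul {n : ℕ} {A B : Matrix (Fin n) (Fin n) ℂ[X]} {z : ℂ}
    {N : Submodule ℂ (Fin n → ℂ)} (hB : IsUnit (B.map (eval z)))
    (h : ∀ b, ((A * B).map (eval z)).col b ∈ N) (b : Fin n) : (A.map (eval z)).col b ∈ N := by
  have : A.map (eval z) = (A * B).map (eval z) * (B.map (eval z))⁻¹ := by
    rw [map_eval_mul, Matrix.mul_nonsing_inv_cancel_right _ _
      ((Matrix.isUnit_iff_isUnit_det _).1 hB)]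
  rw [this]
  exact col_mul_mem h _

theorem isUnit_fl {n : ℕ} {A : Matrix (Fin n) (Fin n) ℂ} (h : IsUnit A) : IsUnit (fl A) := by
  have : fl A = A.transpose.submatrix Fin.revPerm Fin.revPerm := rfl
  rw [this, Matrix.isUnit_submatrix_equiv]
  exact (Matrix.isUnit_transpose A).2 h

section Refactor

variable {n ℓ k : ℕ} {σ τ : ℂ} {M N Q : Submodule ℂ (Fin n → ℂ)}
  {A B A' B' D : Matrix (Fin n) (Fin n) ℂ[X]}

/-- Since `B'` degenerates only at `τ`, its flip can be cancelled at `σ`. Thus `fl E` has its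
columns in the space realized by `D`, and uniqueness gives `D = fl E` and then `A' = E`. -/
theorem mul_eq_mul_of_ne (hℓ : ℓ < n) (hk : k < n) (hσ : σ ≠ 0) (hτ : τ ≠ 0) (hστ : σ ≠ τ)
    (hM : Module.finrank ℂ M = ℓ) (hA : Realizes ℓ σ M A)
    (hN : Module.finrank ℂ N = k) (hB : Realizes k τ N B)
    (hNf : Module.finrank ℂ (firstCols k ((A * B).map (eval τ))) = k)
    (hB' : Realizes k τ (firstCols k ((A * B).map (eval τ))) B')
    (hMf : Module.finrank ℂ (firstCols ℓ ((fl B * fl A).map (eval σ))) = ℓ)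
    (hD : Realizes ℓ σ (firstCols ℓ ((fl B * fl A).map (eval σ))) D)
    (hA' : Realizes ℓ σ (firstCols ℓ ((fl D).map (eval σ))) A') : A * B = B' * A' := by
  obtain ⟨E, hE⟩ := hB'.exists_mul hk.le hτ
    (cols_mem_of_rank_le (rank_mul_eval_le (Or.inr (hB.rank_le hN))) hNf)
  have hband : Band (n - ℓ) E := by
    refine hB'.band.of_mul_left hB'.diag ?_
    rw [hE, add_comm]
    exact hA.band.mul hB.band
  have hflE : ∀ b, ((fl E).map (eval σ)).col b ∈ firstCols ℓ ((fl B * fl A).map (eval σ)) := by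
    have hflAB : fl E * fl B' = fl B * fl A := by rw [← fl_mul, ← fl_mul, hE]
    refine cols_mem_of_mul (B := fl B') (isUnit_fl (hB'.isUnit_eval hk.le hτ hστ)) fun b => ?_
    rw [hflAB]
    refine cols_mem_of_rank_le (rank_mul_eval_le (Or.inr ?_)) hMf b
    rw [← fl_map, rank_fl]
    exact hA.rank_le hM
  have hDE : D = fl E := hD.eq_of_band hℓ.le hσ hband.fl hflE
  have hEA : A' = E := by
    refine hA'.eq_of_band hℓ.le hσ hband ?_
    rw [hDE, fl_fl]
    -- The flip preserves rank, so `E` inherits from `D` the bound `ℓ` on its rank at `σ`, and its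
    -- first `ℓ` columns span.
    refine cols_mem_of_rank_le ?_ (hband.finrank_firstCols hℓ.le σ)
    rw [← rank_fl, fl_map, ← hDE]
    exact hD.rank_le hMf
  rw [hEA, hE]

/-- Both factors now degenerate at the same point, so cancellation is unavailable. Definedness of
the two projections gives `k ≤ ℓ` and `ℓ ≤ k`; then the product has the column space of its left
factor, so `B' = A` and `A' = B`. -/
theorem mul_eq_mul_of_eq (hℓ : ℓ < n) (hk : k < n) (hσ : σ ≠ 0)
    (hM : Module.finrank ℂ M = ℓ) (hA : Realizes ℓ σ M A)
    (hN : Module.finrank ℂ N = k) (hB : Realizes k σ N B)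
    (hQ : Module.finrank ℂ Q = k) (hQB : Realizes k σ Q (fl B))
    (hNf : Module.finrank ℂ (firstCols k ((A * B).map (eval σ))) = k)
    (hB' : Realizes k σ (firstCols k ((A * B).map (eval σ))) B')
    (hMf : Module.finrank ℂ (firstCols ℓ ((fl B * fl A).map (eval σ))) = ℓ)
    (hD : Realizes ℓ σ (firstCols ℓ ((fl B * fl A).map (eval σ))) D)
    (hA' : Realizes ℓ σ (firstCols ℓ ((fl D).map (eval σ))) A') : A * B = B' * A' := by
  have hkℓ : k ≤ ℓ := by
    rw [← hNf]
    exact (firstCols_le_rank _).trans (rank_mul_eval_le (Or.inl (hA.rank_le hM)))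
  have hℓk : ℓ ≤ k := by
    rw [← hMf]
    exact (firstCols_le_rank _).trans (rank_mul_eval_le (Or.inl (hQB.rank_le hQ)))
  obtain rfl : k = ℓ := le_antisymm hkℓ hℓk
  have h1 : firstCols k ((A * B).map (eval σ)) = M :=
    Submodule.eq_of_le_of_finrank_eq (firstCols_le (cols_mul_mem hA.col_mem)) (hNf.trans hM.symm)
  have h2 : firstCols k ((fl B * fl A).map (eval σ)) = Q :=
    Submodule.eq_of_le_of_finrank_eq (firstCols_le (cols_mul_mem hQB.col_mem))
      (hMf.trans hQ.symm)
  rw [h1] at hB'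
  rw [h2] at hD
  have h3 : D = fl B := hD.eq_of_band hk.le hσ hQB.band hQB.col_mem
  rw [h3, fl_fl] at hA'
  have h4 : A' = B := hA'.eq_of_band hk.le hσ hB.band
    (cols_mem_of_rank_le (hB.rank_le hN) (hB.band.finrank_firstCols hk.le σ))
  rw [h4, hB'.eq_of_band hk.le hσ hA.band hA.col_mem]

end Refactor

/-! ### The rational maps on points -/

theorem mem_evalProj {n k : ℕ} {z : ℂˣ} {A : Matrix (Fin n) (Fin n) ℂ[X]} {x : X n k} :
    x ∈ evalProj k z A ↔
      x.2 = z ∧ x.1.1 = firstCols k (A.map (eval ((-1) ^ (k - 1) * (z : ℂ)))) := by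
  constructor
  · rintro ⟨h, rfl⟩
    exact ⟨rfl, rfl⟩
  · rintro ⟨rfl, h⟩
    refine ⟨?_, ?_⟩
    · change Module.finrank ℂ (firstCols k _) = k
      rw [← h]
      exact x.1.2
    · exact Prod.ext (Subtype.ext h.symm) rfl

theorem mem_g {n k : ℕ} [NeZero k] {x : X n k} {A : Bminus n} :
    A ∈ g x ↔ CyclicNonzero (rep x.1) ∧ A.1 = gMatrix (rep x.1) x.2 := by
  constructor
  · rintro ⟨h, rfl⟩
    exact ⟨h, rfl⟩
  · rintro ⟨h, hA⟩
    exact ⟨h, Subtype.ext hA.symm⟩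

theorem realizes_of_mem_g {n k : ℕ} [NeZero k] (hk : k < n) {x : X n k} {A : Bminus n}
    (h : A ∈ g x) : Realizes k ((-1) ^ (k - 1) * (x.2 : ℂ)) x.1.1 A.1 := by
  obtain ⟨h1, h2⟩ := mem_g.1 h
  rw [h2]
  exact realizes_gMatrix hk (rep_spec _) h1 _

theorem mem_S {n k : ℕ} [NeZero k] {x y : X n k} :
    y ∈ S x ↔ ∃ A ∈ g x, y ∈ evalProj k x.2 (fl A.1) := by
  simp [S, Part.mem_bind_iff]

theorem mem_Psi {n k ℓ : ℕ} [NeZero k] [NeZero ℓ] {u : X n ℓ} {v y : X n k} :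
    y ∈ Psi k ℓ (u, v) ↔ ∃ A ∈ g u, ∃ B ∈ g v, y ∈ evalProj k v.2 (A.1 * B.1) := by
  constructor
  · intro h
    obtain ⟨_, ⟨⟨hA, hB⟩, rfl⟩, h⟩ := Part.mem_bind_iff.1 h
    exact ⟨_, ⟨hA, rfl⟩, _, ⟨hB, rfl⟩, h⟩
  · rintro ⟨_, ⟨hA, rfl⟩, _, ⟨hB, rfl⟩, h⟩
    exact Part.mem_bind_iff.2 ⟨_, ⟨⟨hA, hB⟩, rfl⟩, h⟩

theorem mem_geomR {n ℓ k : ℕ} [NeZero ℓ] [NeZero k] {u u' : X n ℓ} {v v' : X n k} :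
    (v', u') ∈ geomR (u, v) ↔ v' ∈ Psi k ℓ (u, v) ∧
      ∃ v₁ ∈ S v, ∃ u₁ ∈ S u, ∃ y ∈ Psi ℓ k (v₁, u₁), u' ∈ S y := by
  rw [geomR, PFun.mem_prodLift]
  refine and_congr_right fun _ => ?_
  have hcomp : S.comp ((Psi ℓ k).comp S₂) (u, v) = ((S₂ (u, v)).bind (Psi ℓ k)).bind S := rfl
  constructor
  · intro h
    rw [hcomp] at h
    obtain ⟨y, hy, h3⟩ := Part.mem_bind_iff.1 h
    obtain ⟨⟨v₁, u₁⟩, h1, h2⟩ := Part.mem_bind_iff.1 hy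
    obtain ⟨hv, hu⟩ := PFun.mem_prodLift.1 h1
    exact ⟨v₁, hv, u₁, hu, y, h2, h3⟩
  · rintro ⟨v₁, hv, u₁, hu, y, hy, h⟩
    rw [hcomp]
    exact Part.mem_bind_iff.2 ⟨y, Part.mem_bind_iff.2
      ⟨(v₁, u₁), PFun.mem_prodLift.2 ⟨hv, hu⟩, hy⟩, h⟩

theorem neg_one_pow_mul_ne_zero (k : ℕ) (t : ℂˣ) : (-1 : ℂ) ^ (k - 1) * (t : ℂ) ≠ 0 :=
  mul_ne_zero (pow_ne_zero _ (neg_ne_zero.2 one_ne_zero)) t.ne_zero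

/-- This is `g ∘ S = fl ∘ g`: the flip is again a band matrix, with the same rank bound, so it
realizes the span of its own first `k` columns. -/
theorem eq_fl_of_mem_S {n k : ℕ} [NeZero k] (hk : k < n) {x y : X n k} {A C : Bminus n}
    (hA : A ∈ g x) (hy : y ∈ S x) (hC : C ∈ g y) : C.1 = fl A.1 ∧ y.2 = x.2 := by
  obtain ⟨A₁, hA₁, h⟩ := mem_S.1 hy
  obtain rfl := Part.mem_unique hA hA₁
  obtain ⟨h1, h2⟩ := mem_evalProj.1 h
  have hC' := realizes_of_mem_g hk hC
  have hA' := realizes_of_mem_g hk hA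
  rw [h1, h2] at hC'
  have h3 := hA'.fl hk.le x.1.2 hC'.generic
  exact ⟨hC'.eq_of_band hk.le (neg_one_pow_mul_ne_zero k _) h3.band h3.col_mem, h1⟩

theorem g_comp_geomR {n ℓ k : ℕ} [NeZero ℓ] [NeZero k] (hℓ : ℓ < n) (hk : k < n)
    {u u' : X n ℓ} {v v' : X n k} (hR : (v', u') ∈ geomR (u, v)) {B' A' : Bminus n}
    (hB' : B' ∈ g v') (hA' : A' ∈ g u') : ∃ A ∈ g u, ∃ B ∈ g v, A * B = B' * A' := by
  obtain ⟨hΨ, v₁, hv₁, u₁, hu₁, y, hy, hu'⟩ := mem_geomR.1 hR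
  obtain ⟨A, hA, B, hB, hv'⟩ := mem_Psi.1 hΨ
  refine ⟨A, hA, B, hB, Subtype.ext ?_⟩
  obtain ⟨B₁, hB₁, A₁, hA₁, hy'⟩ := mem_Psi.1 hy
  obtain ⟨hB₁', htv⟩ := eq_fl_of_mem_S hk hB hv₁ hB₁
  obtain ⟨hA₁', htu⟩ := eq_fl_of_mem_S hℓ hA hu₁ hA₁
  obtain ⟨D, hD, hu''⟩ := mem_S.1 hu'
  rw [mem_evalProj] at hv' hy' hu''
  rw [hA₁', hB₁', htu] at hy'
  rw [hy'.1] at hu''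
  have rA := realizes_of_mem_g hℓ hA
  have rB := realizes_of_mem_g hk hB
  have rB' := realizes_of_mem_g hk hB'
  have rA' := realizes_of_mem_g hℓ hA'
  have rD := realizes_of_mem_g hℓ hD
  have rB₁ := realizes_of_mem_g hk hB₁
  have hdv' := v'.1.2
  have hdy := y.1.2
  rw [hv'.1, hv'.2] at rB'
  rw [hy'.1, hy'.2] at rD
  rw [hu''.1, hu''.2] at rA'
  rw [hB₁', htv] at rB₁
  rw [hv'.2] at hdv'
  rw [hy'.2] at hdy
  have hτ := neg_one_pow_mul_ne_zero k v.2
  have hσ := neg_one_pow_mul_ne_zero ℓ u.2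
  by_cases hστ : (-1 : ℂ) ^ (ℓ - 1) * (u.2 : ℂ) = (-1) ^ (k - 1) * (v.2 : ℂ)
  · rw [← hστ] at rB rB' rB₁ hdv'
    exact mul_eq_mul_of_eq hℓ hk hσ u.1.2 rA v.1.2 rB v₁.1.2 rB₁ hdv' rB' hdy rD rA'
  · exact mul_eq_mul_of_ne hℓ hk hσ hτ hστ u.1.2 rA v.1.2 rB hdv' rB' hdy rD rA'

/-! ### Toeplitz matrices -/

/-- The folded matrix that acts on unfolded vectors as multiplication by `w`. -/
def toeplitz (n : ℕ) (w : ℂ[X]) : Matrix (Fin n) (Fin n) ℂ[X] :=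
  Matrix.of fun i b => ∑ d ∈ Finset.range 2,
    monomial d (if (b : ℕ) ≤ i + n * d then w.coeff (i + n * d - b) else 0)

/-- Two powers of `λ` suffice: for `2 ≤ d` the index `i + n * d - b` exceeds `n`, hence the degree
of `w`. -/
theorem coeff_toeplitz {n : ℕ} {w : ℂ[X]} (hw : w.natDegree < n) (i b : Fin n) (d : ℕ) :
    (toeplitz n w i b).coeff d =
      if (b : ℕ) ≤ i + n * d then w.coeff (i + n * d - b) else 0 := by
  simp only [toeplitz, Matrix.of_apply, finsetSum_coeff, coeff_monomial]
  rw [Finset.sum_ite_eq' (Finset.range 2) d]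
  simp only [Finset.mem_range]
  by_cases hd : d < 2
  · rw [if_pos hd]
  · have h1 : n * 2 ≤ n * d := Nat.mul_le_mul_left n (by omega)
    rw [if_neg hd, coeff_eq_zero_of_natDegree_lt (by omega), ite_self]

theorem unfold_col_toeplitz {n : ℕ} {w : ℂ[X]} (hw : w.natDegree < n) (b : Fin n) :
    unfold ((toeplitz n w).col b) = Polynomial.X ^ (b : ℕ) * w := by
  ext p
  obtain ⟨i, d, rfl⟩ := exists_position b.pos p
  rw [coeff_unfold, coeff_X_pow_mul', Matrix.col_apply, coeff_toeplitz hw]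

theorem unfold_toeplitz_mulVec {n : ℕ} {w : ℂ[X]} (hw : w.natDegree < n) (q : Fin n → ℂ[X]) :
    unfold ((toeplitz n w).mulVec q) = w * unfold q := by
  rw [unfold_mulVec, unfold, Finset.mul_sum]
  refine Finset.sum_congr rfl fun j _ => ?_
  rw [unfold_col_toeplitz hw]
  ring

theorem toeplitz_mul_comm {n : ℕ} {w w' : ℂ[X]} (hw : w.natDegree < n) (hw' : w'.natDegree < n) :
    toeplitz n w * toeplitz n w' = toeplitz n w' * toeplitz n w := by
  apply Matrix.ext_col
  intro b
  apply unfold_injective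
  have hcol : ∀ A B : Matrix (Fin n) (Fin n) ℂ[X], (A * B).col b = A.mulVec (B.col b) :=
    fun _ _ => rfl
  rw [hcol, hcol, unfold_toeplitz_mulVec hw, unfold_toeplitz_mulVec hw', unfold_col_toeplitz hw,
    unfold_col_toeplitz hw']
  ring

/-- The entries depend only on the offset `i + n * d - b`. -/
theorem fl_toeplitz {n : ℕ} (w : ℂ[X]) : fl (toeplitz n w) = toeplitz n w := by
  ext1 i b
  simp only [fl, toeplitz, Matrix.of_apply, Fin.val_rev]
  refine Finset.sum_congr rfl fun d _ => ?_
  have hi := i.2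
  have hb := b.2
  congr 1
  by_cases h : (b : ℕ) ≤ i + n * d
  · rw [if_pos h, if_pos (by omega)]
    congr 1
    omega
  · rw [if_neg h, if_neg (by omega)]

theorem band_toeplitz {n : ℕ} {w : ℂ[X]} (hw : w.natDegree < n) (hmonic : w.Monic) :
    Band w.natDegree (toeplitz n w) := by
  refine band_iff_unfold.2 fun b => ?_
  rw [unfold_col_toeplitz hw]
  refine ⟨dvd_mul_right _ _, natDegree_mul_le.trans (by simp), ?_⟩
  rw [add_comm, coeff_X_pow_mul]
  exact hmonic

/-! ### Spans of eigenvectors of the cyclic shift -/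

/-- The vectors whose generating polynomial vanishes at all `ζ a`. -/
def rootSpace {n m : ℕ} (ζ : Fin m → ℂ) : Submodule ℂ (Fin n → ℂ) where
  carrier := {v | ∀ a, ∑ i : Fin n, ζ a ^ (i : ℕ) * v i = 0}
  zero_mem' := by simp
  add_mem' := fun hv hv' a => by simp [mul_add, Finset.sum_add_distrib, hv a, hv' a]
  smul_mem' := fun c v hv a => by
    have : ∀ i : Fin n, ζ a ^ (i : ℕ) * (c • v) i = c * (ζ a ^ (i : ℕ) * v i) := fun i => by
      simp only [Pi.smul_apply, smul_eq_mul]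
      ring
    simp only [this, ← Finset.mul_sum, hv a, mul_zero]

theorem eval_mem_rootSpace {n m : ℕ} {ζ : Fin m → ℂ} {μ : ℂ} (hζ : ∀ a, ζ a ^ n = μ)
    (f : Fin n → ℂ[X]) :
    (fun i => (f i).eval μ) ∈ rootSpace ζ ↔ ∀ a, (unfold f).eval (ζ a) = 0 := by
  refine forall_congr' fun a => ?_
  rw [eval_unfold, hζ]

/-- A vector vanishing on `k` cyclically consecutive rows lifts to `x^b * w` with `deg w < n - k`,
while `w` has the `n - k` distinct roots `ζ a`. -/
theorem cyclicGeneric_rootSpace {n k : ℕ} (hk : k < n) {ζ : Fin (n - k) → ℂ} {μ : ℂ}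
    (hμ : μ ≠ 0) (hζ : ∀ a, ζ a ^ n = μ) (hinj : Function.Injective ζ) :
    CyclicGeneric k (rootSpace ζ : Submodule ℂ (Fin n → ℂ)) := by
  intro j hj1 hjn v hv hva
  obtain ⟨b, rfl⟩ : ∃ b : Fin n, j = b + 1 := ⟨⟨(j - 1).toNat, by omega⟩, by
    simp only
    omega⟩
  -- Coordinates before `b` are moved up one period, with the factor `λ / μ`, which is `1` at `μ`.
  let f : Fin n → ℂ[X] := fun i => if (b : ℕ) ≤ i then C (v i) else C (v i / μ) * Polynomial.X
  have hf : (fun i => (f i).eval μ) = v := by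
    ext i
    simp only [f]
    split_ifs
    · simp
    · simp [div_mul_cancel₀ _ hμ]
  have hb := b.2
  have hcoeff : ∀ (i : Fin n) (d : ℕ), (f i).coeff d ≠ 0 →
      (b : ℕ) ≤ i + n * d ∧ i + n * d < b + (n - k) := by
    intro i d h0
    have hi := i.2
    have hres : ¬ i ∈ residues n (Finset.Icc ((b : ℤ) + 1 - k) (b + 1 - 1)) := by
      intro h
      apply h0
      simp [f, hva i h]
    rw [mem_residues_Icc (by omega) (by omega)] at hres
    simp only [f] at h0
    split_ifs at h0 with h1
    · have hd : d = 0 := by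
        by_contra hd
        exact h0 (coeff_C_of_ne_zero hd)
      subst hd
      omega
    · have hd : d = 1 := by
        by_contra hd
        exact h0 (by rw [coeff_C_mul, coeff_X_of_ne_one hd, mul_zero])
      subst hd
      omega
  have hdvd : Polynomial.X ^ (b : ℕ) ∣ unfold f := X_pow_dvd_iff.2 fun p hp => by
    obtain ⟨i, d, rfl⟩ := exists_position b.pos p
    rw [coeff_unfold]
    by_contra h0
    have := hcoeff i d h0
    omega
  obtain ⟨w, hw⟩ := hdvd
  have hwdeg : ∀ p, n - k ≤ p → w.coeff p = 0 := by
    intro p hp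
    have h1 : w.coeff p = (unfold f).coeff (p + b) := by rw [hw, coeff_X_pow_mul]
    rw [h1]
    obtain ⟨i, d, hid⟩ := exists_position b.pos (p + b)
    rw [hid, coeff_unfold]
    by_contra h0
    have := hcoeff i d h0
    omega
  rw [← hf, eval_mem_rootSpace hζ] at hv
  have hw0 : w = 0 := by
    refine eq_zero_of_natDegree_lt_card_of_eval_eq_zero w hinj (fun a => ?_) ?_
    · have h1 := hv a
      rw [hw, eval_mul, eval_pow, eval_X] at h1
      refine (mul_eq_zero.1 h1).resolve_left (pow_ne_zero _ fun h => hμ ?_)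
      rw [← hζ a, h, zero_pow (by omega)]
    · rw [Fintype.card_fin]
      by_cases hw : w = 0
      · simp [hw]
        omega
      · exact (natDegree_lt_iff_degree_lt hw).2 (degree_lt_iff_coeff_zero _ _ |>.2 hwdeg)
  have hf0 : f = 0 := unfold_injective (by rw [hw, hw0, mul_zero, unfold_zero])
  rw [← hf, hf0]
  ext i
  simp

theorem CyclicGeneric.finrank_le {n k : ℕ} (hk : k < n) {N : Submodule ℂ (Fin n → ℂ)}
    (h : CyclicGeneric k N) : Module.finrank ℂ N ≤ k := by
  let R := residues n (Finset.Icc ((1 : ℤ) - k) (1 - 1))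
  have hR : R.card = k := card_residues_Icc k hk.le (by ring)
  let L : N →ₗ[ℂ] (R → ℂ) := (LinearMap.funLeft ℂ ℂ (fun a : R => (a : Fin n))).comp N.subtype
  have hL : Function.Injective L := by
    rw [← LinearMap.ker_eq_bot, LinearMap.ker_eq_bot']
    intro v hv
    exact Subtype.ext (h 1 le_rfl (by omega) v v.2 fun a ha => congrFun hv ⟨a, ha⟩)
  have := LinearMap.finrank_le_finrank_of_injective hL
  rwa [Module.finrank_fintype_fun_eq_card, Fintype.card_coe, hR] at this

theorem exists_roots {n : ℕ} (m : ℕ) (hm : m ≤ n) {c : ℂ} (hc : c ≠ 0) :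
    ∃ ζ : Fin m → ℂ, Function.Injective ζ ∧ ∀ a, ζ a ^ n = c ^ n := by
  rcases Nat.eq_zero_or_pos n with rfl | hn
  · obtain rfl : m = 0 := by omega
    exact ⟨Fin.elim0, fun a => a.elim0, fun a => a.elim0⟩
  have hω := Complex.isPrimitiveRoot_exp n hn.ne'
  set ω := Complex.exp (2 * Real.pi * Complex.I / n)
  refine ⟨fun a => c * ω ^ (a : ℕ), fun a a' h => ?_, fun a => ?_⟩
  · exact Fin.ext (hω.pow_inj (by omega) (by omega) (mul_left_cancel₀ hc h))
  · rw [mul_pow, ← pow_mul, mul_comm (a : ℕ), pow_mul, hω.pow_eq_one, one_pow, mul_one]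

/-- There are points of the Grassmannian that are realized by Toeplitz matrices. -/
theorem exists_realizes_toeplitz {n k : ℕ} (hk0 : 0 < k) (hk : k < n) {c : ℂ} (hc : c ≠ 0) :
    ∃ (N : Gr k n) (w : ℂ[X]), w.natDegree < n ∧ Realizes k (c ^ n) N.1 (toeplitz n w) := by
  obtain ⟨ζ, hinj, hζ⟩ := exists_roots (n - k) (Nat.sub_le n k) hc
  have hμ : c ^ n ≠ 0 := pow_ne_zero n hc
  let w : ℂ[X] := ∏ a, (Polynomial.X - C (ζ a))
  have hmonic : w.Monic := monic_prod_of_monic _ _ fun a _ => monic_X_sub_C _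
  have hdeg : w.natDegree = n - k := by
    simp [w, natDegree_prod_of_monic _ _ fun a _ => monic_X_sub_C (ζ a)]
  have hroot : ∀ a, w.eval (ζ a) = 0 := fun a => by
    rw [eval_prod]
    exact Finset.prod_eq_zero (Finset.mem_univ a) (by simp)
  have hlt : w.natDegree < n := by omega
  have hband := band_toeplitz hlt hmonic
  rw [hdeg] at hband
  have hgen := cyclicGeneric_rootSpace hk hμ hζ hinj
  have hcol : ∀ b, ((toeplitz n w).map (eval (c ^ n))).col b ∈ rootSpace ζ := fun b =>
    (eval_mem_rootSpace hζ ((toeplitz n w).col b)).2 fun a => by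
      rw [unfold_col_toeplitz hlt, eval_mul, hroot, mul_zero]
  have hfin : Module.finrank ℂ (rootSpace ζ : Submodule ℂ (Fin n → ℂ)) = k := by
    -- Genericity bounds the dimension above; the `k` independent columns of the Toeplitz matrix
    -- bound it below.
    refine le_antisymm (hgen.finrank_le hk) ?_
    exact (hband.finrank_firstCols hk.le (c ^ n)).ge.trans
      (Submodule.finrank_mono (firstCols_le hcol))
  refine ⟨⟨rootSpace ζ, hfin⟩, w, hlt, hgen, hband, hcol, fun i => ?_⟩
  rw [coeff_toeplitz hlt, if_pos (by simp)]
  simp only [mul_zero, add_zero, Nat.sub_self]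
  rw [coeff_zero_eq_eval_zero, eval_prod, Finset.prod_ne_zero_iff]
  intro a _ h
  have h0 : ζ a = 0 := by simpa using h
  have := hζ a
  rw [h0, zero_pow (by omega)] at this
  exact hμ this.symm

theorem firstCols_mul {n k : ℕ} (U B : Matrix (Fin n) (Fin n) ℂ) :
    firstCols k (U * B) = (firstCols k B).map U.mulVecLin := by
  rw [firstCols, firstCols, Submodule.map_span, ← Set.image_comp]
  rfl

/-- Commuting puts the columns of `A * B` in `N`, and invertibility of `A` at `μ` keeps the first
`k` of them independent. This makes `Ψ` return its second argument at Toeplitz points. -/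
theorem firstCols_mul_of_comm {n k : ℕ} (hk : k < n) {μ : ℂ} {N : Gr k n}
    {A B : Matrix (Fin n) (Fin n) ℂ[X]} (hB : Realizes k μ N.1 B) (hcomm : A * B = B * A)
    (hA : IsUnit (A.map (eval μ))) :
    firstCols k ((A * B).map (eval μ)) = N.1 := by
  refine Submodule.eq_of_le_of_finrank_eq (firstCols_le ?_) ?_
  · rw [hcomm]
    exact cols_mul_mem hB.col_mem
  · have hinj : Function.Injective (A.map (eval μ)).mulVecLin :=
      Matrix.mulVec_injective_of_isUnit hA
    rw [map_eval_mul, firstCols_mul, N.2]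
    exact (Submodule.equivMapOfInjective _ hinj _).finrank_eq.symm.trans
      (hB.band.finrank_firstCols hk.le μ)

/-! ### Zariski neighbourhoods and regular functions -/

/-- The filter of Zariski neighbourhoods of a point of affine space. -/
def zariskiNhds {ι : Type*} (p₀ : ι → ℂ) : Filter (ι → ℂ) where
  sets := {U | ∃ F : MvPolynomial ι ℂ, MvPolynomial.eval p₀ F ≠ 0 ∧
    ∀ p, MvPolynomial.eval p F ≠ 0 → p ∈ U}
  univ_sets := ⟨1, by simp, fun _ _ => trivial⟩
  sets_of_superset := fun ⟨F, h1, h2⟩ hUV => ⟨F, h1, fun p hp => hUV (h2 p hp)⟩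
  inter_sets := fun ⟨F, h1, h2⟩ ⟨F', h1', h2'⟩ => ⟨F * F', by simp [h1, h1'], fun p hp => by
    rw [map_mul] at hp
    exact ⟨h2 p (left_ne_zero_of_mul hp), h2' p (right_ne_zero_of_mul hp)⟩⟩

theorem eventually_zariskiNhds {ι : Type*} {p₀ : ι → ℂ} {P : (ι → ℂ) → Prop} :
    (∀ᶠ p in zariskiNhds p₀, P p) ↔ ∃ F : MvPolynomial ι ℂ, MvPolynomial.eval p₀ F ≠ 0 ∧
      ∀ p, MvPolynomial.eval p F ≠ 0 → P p := Iff.rfl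

theorem eventually_eval_ne_zero {ι : Type*} {p₀ : ι → ℂ} {F : MvPolynomial ι ℂ}
    (h : MvPolynomial.eval p₀ F ≠ 0) :
    ∀ᶠ p in zariskiNhds p₀, MvPolynomial.eval p F ≠ 0 := ⟨F, h, fun _ => id⟩

/-- The functions that agree with a rational function regular at `p₀` in a Zariski neighbourhood
of `p₀`. -/
def regularAt {ι : Type*} (p₀ : ι → ℂ) : Subring ((ι → ℂ) → ℂ) where
  carrier := {f | ∃ a b : MvPolynomial ι ℂ, MvPolynomial.eval p₀ b ≠ 0 ∧
    ∀ᶠ p in zariskiNhds p₀, f p = MvPolynomial.eval p a / MvPolynomial.eval p b}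
  mul_mem' := by
    rintro f f' ⟨a, b, hb, h⟩ ⟨a', b', hb', h'⟩
    refine ⟨a * a', b * b', by simp [hb, hb'], ?_⟩
    filter_upwards [h, h'] with p hp hp'
    simp only [Pi.mul_apply, map_mul, hp, hp', div_mul_div_comm]
  one_mem' := ⟨1, 1, by simp, .of_forall fun p => by simp⟩
  add_mem' := by
    rintro f f' ⟨a, b, hb, h⟩ ⟨a', b', hb', h'⟩
    refine ⟨a * b' + b * a', b * b', by simp [hb, hb'], ?_⟩
    filter_upwards [h, h', eventually_eval_ne_zero hb, eventually_eval_ne_zero hb']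
      with p hp hp' h0 h0'
    simp only [Pi.add_apply, map_mul, map_add, hp, hp', div_add_div _ _ h0 h0']
  zero_mem' := ⟨0, 1, by simp, .of_forall fun p => by simp⟩
  neg_mem' := by
    rintro f ⟨a, b, hb, h⟩
    refine ⟨-a, b, hb, ?_⟩
    filter_upwards [h] with p hp
    simp only [Pi.neg_apply, hp, map_neg, neg_div]

section Regular

variable {ι : Type*} {p₀ : ι → ℂ} {f f' : (ι → ℂ) → ℂ}

theorem coordinate_mem_regularAt (c : ι) : (fun p => p c) ∈ regularAt p₀ :=
  ⟨.X c, 1, by simp, .of_forall fun p => by simp⟩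

theorem const_mem_regularAt (c : ℂ) : (fun _ => c) ∈ regularAt p₀ :=
  ⟨.C c, 1, by simp, .of_forall fun p => by simp⟩

theorem eventually_ne_zero_of_regularAt (hf : f ∈ regularAt p₀) (h0 : f p₀ ≠ 0) :
    ∀ᶠ p in zariskiNhds p₀, f p ≠ 0 := by
  obtain ⟨a, b, hb, h⟩ := hf
  -- The point `p₀` lies in each of its own neighbourhoods, so the equality holds there too.
  have hself : f p₀ = MvPolynomial.eval p₀ a / MvPolynomial.eval p₀ b := by
    obtain ⟨F, hF, hF'⟩ := h
    exact hF' p₀ hF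
  rw [hself] at h0
  filter_upwards [h, eventually_eval_ne_zero (div_ne_zero_iff.1 h0).1,
    eventually_eval_ne_zero hb] with p hp ha hb
  rw [hp]
  exact div_ne_zero ha hb

theorem div_mem_regularAt (hf : f ∈ regularAt p₀) (hf' : f' ∈ regularAt p₀) (h0 : f' p₀ ≠ 0) :
    (fun p => f p / f' p) ∈ regularAt p₀ := by
  have hinv : (fun p => (f' p)⁻¹) ∈ regularAt p₀ := by
    obtain ⟨a, b, hb, h⟩ := hf'
    have hself : f' p₀ = MvPolynomial.eval p₀ a / MvPolynomial.eval p₀ b := by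
      obtain ⟨F, hF, hF'⟩ := h
      exact hF' p₀ hF
    rw [hself] at h0
    refine ⟨b, a, (div_ne_zero_iff.1 h0).1, ?_⟩
    filter_upwards [h] with p hp
    rw [hp, inv_div]
  simp only [div_eq_mul_inv]
  exact mul_mem hf hinv

theorem sum_mem_regularAt {α : Type*} (s : Finset α) {f : α → (ι → ℂ) → ℂ}
    (hf : ∀ i ∈ s, f i ∈ regularAt p₀) : (fun p => ∑ i ∈ s, f i p) ∈ regularAt p₀ := by
  have : (fun p => ∑ i ∈ s, f i p) = ∑ i ∈ s, f i := by
    ext p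
    simp
  rw [this]
  exact sum_mem hf

theorem det_mem_regularAt {k : ℕ} {Z : (ι → ℂ) → Matrix (Fin k) (Fin k) ℂ}
    (hZ : ∀ i j, (fun p => Z p i j) ∈ regularAt p₀) :
    (fun p => (Z p).det) ∈ regularAt p₀ := by
  simp only [Matrix.det_apply]
  refine sum_mem_regularAt _ fun π _ => ?_
  have : (fun p => Equiv.Perm.sign π • ∏ i, Z p (π i) i)
      = Equiv.Perm.sign π • ∏ i, fun p => Z p (π i) i := by
    ext p
    simp
  rw [this, Units.smul_def]
  exact zsmul_mem (prod_mem fun i _ => hZ _ _) _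

variable {n k ℓ : ℕ} {Z : (ι → ℂ) → Matrix (Fin n) (Fin k) ℂ} {t z : (ι → ℂ) → ℂ}

theorem plucker_mem_regularAt (hZ : ∀ i j, (fun p => Z p i j) ∈ regularAt p₀) (I : Finset ℤ) :
    (fun p => plucker (Z p) I) ∈ regularAt p₀ := by
  unfold plucker minor
  split_ifs
  · exact det_mem_regularAt fun i j => hZ _ _
  · exact const_mem_regularAt 0

theorem gMatrix_mem_regularAt (hZ : ∀ i j, (fun p => Z p i j) ∈ regularAt p₀)
    (ht : t ∈ regularAt p₀) (hz : z ∈ regularAt p₀) (h0 : CyclicNonzero (Z p₀)) (i b : Fin n) :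
    (fun p => (gMatrix (Z p) (t p) i b).eval (z p)) ∈ regularAt p₀ := by
  simp only [gMatrix, Matrix.of_apply, eval_mul, eval_C]
  refine mul_mem (S := Subring _) (a := fun p => eval (z p) (coeffC k (t p) (i + 1) (b + 1))) ?_
    (div_mem_regularAt (plucker_mem_regularAt hZ _) (plucker_mem_regularAt hZ _)
      (h0 (b + 1) (by omega) (by omega)))
  unfold coeffC
  split_ifs
  · simpa using const_mem_regularAt 1
  · simpa using ht
  · simpa using hz

theorem eventually_cyclicNonzero (hZ : ∀ i j, (fun p => Z p i j) ∈ regularAt p₀)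
    (h0 : CyclicNonzero (Z p₀)) : ∀ᶠ p in zariskiNhds p₀, CyclicNonzero (Z p) := by
  have : ∀ b : Fin n, ∀ᶠ p in zariskiNhds p₀,
      plucker (Z p) (Finset.Icc ((b : ℤ) + 1 - k) ((b : ℤ) + 1 - 1)) ≠ 0 := fun b =>
    eventually_ne_zero_of_regularAt (plucker_mem_regularAt hZ _) (h0 (b + 1) (by omega) (by omega))
  filter_upwards [Filter.eventually_all.2 this] with p hp j hj1 hjn
  have := hp ⟨(j - 1).toNat, by omega⟩
  rwa [show (((⟨(j - 1).toNat, by omega⟩ : Fin n) : ℕ) : ℤ) + 1 = j by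
    simp only
    omega] at this

end Regular

/-! ### The rational maps on matrix representatives -/

/-- The first `k` columns of `A` at `λ = (-1)^(k-1) t`. -/
def projMatrix {n k : ℕ} (hk : k ≤ n) (A : Matrix (Fin n) (Fin n) ℂ[X]) (t : ℂ) :
    Matrix (Fin n) (Fin k) ℂ :=
  (A.map (eval ((-1) ^ (k - 1) * t))).submatrix id (Fin.castLE hk)

theorem CyclicNonzero.finrank {n k : ℕ} (hk : k < n) {Z : Matrix (Fin n) (Fin k) ℂ}
    (h : CyclicNonzero Z) : Module.finrank ℂ (Submodule.span ℂ (Set.range Z.col)) = k := by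
  have h1 := h 1 le_rfl (by omega)
  have hcard : (residues n (Finset.Icc ((1 : ℤ) - k) (1 - 1))).card = k :=
    card_residues_Icc k hk.le (by ring)
  rw [plucker, minor, dif_pos hcard] at h1
  have hli : LinearIndependent ℂ Z.col := LinearIndependent.of_comp
    (LinearMap.funLeft ℂ ℂ (Finset.orderEmbOfFin _ hcard))
    (Matrix.linearIndependent_cols_of_det_ne_zero h1)
  rw [finrank_span_eq_card hli, Fintype.card_fin]

theorem exists_mem_evalProj {n k : ℕ} (hk : k < n) {A : Matrix (Fin n) (Fin n) ℂ[X]} {t : ℂˣ}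
    (h : CyclicNonzero (projMatrix hk.le A (t : ℂ))) :
    ∃ N : Gr k n, IsRep (projMatrix hk.le A (t : ℂ)) N ∧ (N, t) ∈ evalProj k t A :=
  ⟨⟨_, h.finrank hk⟩, rfl, mem_evalProj.2 ⟨rfl, (firstCols_eq_span hk.le _).symm⟩⟩

theorem exists_mem_g {n k : ℕ} [NeZero k] {Z : Matrix (Fin n) (Fin k) ℂ} {N : Gr k n}
    (hZ : IsRep Z N) (h : CyclicNonzero Z) (t : ℂˣ) : ∃ A ∈ g (N, t), A.1 = gMatrix Z t :=
  ⟨⟨gMatrix Z t, gMatrix_mem Z h t⟩, mem_g.2 ⟨(cyclicNonzero_congr hZ (rep_spec N)).1 h,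
    gMatrix_congr hZ (rep_spec N) t⟩, rfl⟩

/-- A matrix representative of `S(N|t)`. -/
def sMatrix {n k : ℕ} (hk : k ≤ n) (Z : Matrix (Fin n) (Fin k) ℂ) (t : ℂ) :
    Matrix (Fin n) (Fin k) ℂ := projMatrix hk (fl (gMatrix Z t)) t

/-- A matrix representative of `Ψ(M|s, N|t)`. -/
def psiMatrix {n k ℓ : ℕ} (hk : k ≤ n) (Z : Matrix (Fin n) (Fin ℓ) ℂ) (s : ℂ)
    (W : Matrix (Fin n) (Fin k) ℂ) (t : ℂ) : Matrix (Fin n) (Fin k) ℂ :=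
  projMatrix hk (gMatrix Z s * gMatrix W t) t

theorem exists_mem_S {n k : ℕ} [NeZero k] (hk : k < n) {Z : Matrix (Fin n) (Fin k) ℂ} {N : Gr k n}
    (hZ : IsRep Z N) (h : CyclicNonzero Z) {t : ℂˣ} (hS : CyclicNonzero (sMatrix hk.le Z t)) :
    ∃ N' : Gr k n, IsRep (sMatrix hk.le Z t) N' ∧ (N', t) ∈ S (N, t) := by
  obtain ⟨A, hA, hAZ⟩ := exists_mem_g hZ h t
  obtain ⟨N', h1, h2⟩ := exists_mem_evalProj hk hS
  exact ⟨N', h1, mem_S.2 ⟨A, hA, by rwa [hAZ]⟩⟩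

theorem exists_mem_Psi {n k ℓ : ℕ} [NeZero k] [NeZero ℓ] (hk : k < n)
    {Z : Matrix (Fin n) (Fin ℓ) ℂ} {M : Gr ℓ n} (hZ : IsRep Z M) (hZ' : CyclicNonzero Z) {s : ℂˣ}
    {W : Matrix (Fin n) (Fin k) ℂ} {N : Gr k n} (hW : IsRep W N) (hW' : CyclicNonzero W) {t : ℂˣ}
    (hΨ : CyclicNonzero (psiMatrix hk.le Z s W t)) :
    ∃ N' : Gr k n, IsRep (psiMatrix hk.le Z s W t) N' ∧ (N', t) ∈ Psi k ℓ ((M, s), (N, t)) := by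
  obtain ⟨A, hA, hAZ⟩ := exists_mem_g hZ hZ' s
  obtain ⟨B, hB, hBW⟩ := exists_mem_g hW hW' t
  obtain ⟨N', h1, h2⟩ := exists_mem_evalProj hk hΨ
  exact ⟨N', h1, mem_Psi.2 ⟨A, hA, B, hB, by rwa [hAZ, hBW]⟩⟩

theorem dom_g_of_isRep {n k : ℕ} [NeZero k] {Z : Matrix (Fin n) (Fin k) ℂ} {N : Gr k n}
    (hZ : IsRep Z N) (h : CyclicNonzero Z) (t : ℂˣ) : (g (N, t)).Dom :=
  (cyclicNonzero_congr hZ (rep_spec N)).1 h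

section Regular

variable {ι : Type*} {p₀ : ι → ℂ} {n k ℓ : ℕ} {Z : (ι → ℂ) → Matrix (Fin n) (Fin ℓ) ℂ}
  {W : (ι → ℂ) → Matrix (Fin n) (Fin k) ℂ} {s t : (ι → ℂ) → ℂ}

theorem sMatrix_mem_regularAt (hk : k ≤ n) (hW : ∀ i j, (fun p => W p i j) ∈ regularAt p₀)
    (ht : t ∈ regularAt p₀) (h0 : CyclicNonzero (W p₀)) (i : Fin n) (j : Fin k) :
    (fun p => sMatrix hk (W p) (t p) i j) ∈ regularAt p₀ := by
  have hz : (fun p => (-1) ^ (k - 1) * t p) ∈ regularAt p₀ := mul_mem (const_mem_regularAt _) ht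
  simp only [sMatrix, projMatrix, fl, Matrix.submatrix_apply, Matrix.map_apply, Matrix.of_apply]
  exact gMatrix_mem_regularAt hW ht hz h0 _ _

theorem psiMatrix_mem_regularAt (hk : k ≤ n) (hZ : ∀ i j, (fun p => Z p i j) ∈ regularAt p₀)
    (hs : s ∈ regularAt p₀) (hZ0 : CyclicNonzero (Z p₀))
    (hW : ∀ i j, (fun p => W p i j) ∈ regularAt p₀)
    (ht : t ∈ regularAt p₀) (hW0 : CyclicNonzero (W p₀)) (i : Fin n) (j : Fin k) :
    (fun p => psiMatrix hk (Z p) (s p) (W p) (t p) i j) ∈ regularAt p₀ := by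
  have hz : (fun p => (-1) ^ (k - 1) * t p) ∈ regularAt p₀ := mul_mem (const_mem_regularAt _) ht
  simp only [psiMatrix, projMatrix, map_eval_mul, Matrix.submatrix_apply, Matrix.mul_apply,
    Matrix.map_apply, id]
  exact sum_mem_regularAt _ fun l _ => mul_mem (gMatrix_mem_regularAt hZ hs hz hZ0 _ _)
    (gMatrix_mem_regularAt hW ht hz hW0 _ _)

end Regular

/-! ### The domain of the geometric `R`-matrix -/

/-- A sufficient condition, in terms of matrix representatives, for `R` to be defined, with both
components of the value in the domain of `g`. -/
theorem exists_mem_geomR {n ℓ k : ℕ} [NeZero ℓ] [NeZero k] (hℓ : ℓ < n) (hk : k < n)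
    {Z : Matrix (Fin n) (Fin ℓ) ℂ} {M : Gr ℓ n} (hZM : IsRep Z M) {s : ℂˣ}
    {W : Matrix (Fin n) (Fin k) ℂ} {N : Gr k n} (hWN : IsRep W N) {t : ℂˣ}
    (hZ : CyclicNonzero Z) (hW : CyclicNonzero W)
    (hΨ : CyclicNonzero (psiMatrix hk.le Z s W t))
    (hSZ : CyclicNonzero (sMatrix hℓ.le Z s)) (hSW : CyclicNonzero (sMatrix hk.le W t))
    (hΨS : CyclicNonzero (psiMatrix hℓ.le (sMatrix hk.le W t) t (sMatrix hℓ.le Z s) s))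
    (hSΨS : CyclicNonzero
      (sMatrix hℓ.le (psiMatrix hℓ.le (sMatrix hk.le W t) t (sMatrix hℓ.le Z s) s) s)) :
    ∃ v' u', (v', u') ∈ geomR ((M, s), (N, t)) ∧ (g v').Dom ∧ (g u').Dom := by
  obtain ⟨N', hN', hv'⟩ := exists_mem_Psi hk hZM hZ hWN hW hΨ
  obtain ⟨N₁, hN₁, hv₁⟩ := exists_mem_S hk hWN hW hSW
  obtain ⟨M₁, hM₁, hu₁⟩ := exists_mem_S hℓ hZM hZ hSZ
  obtain ⟨Y, hY, hy⟩ := exists_mem_Psi hℓ hN₁ hSW hM₁ hSZ hΨS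
  obtain ⟨M', hM', hu'⟩ := exists_mem_S hℓ hY hΨS hSΨS
  exact ⟨(N', t), (M', s), mem_geomR.2 ⟨hv', _, hv₁, _, hu₁, _, hy, hu'⟩,
    dom_g_of_isRep hN' hΨ t, dom_g_of_isRep hM' hSΨS s⟩

/-- A point of `X_k` whose matrix `g` is the Toeplitz matrix of `w`. -/
structure IsToeplitzPoint {n k : ℕ} (N : Gr k n) (t : ℂˣ) (w : ℂ[X]) : Prop where
  natDegree_lt : w.natDegree < n
  realizes : Realizes k ((-1) ^ (k - 1) * (t : ℂ)) N.1 (toeplitz n w)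

theorem exists_isToeplitzPoint {n k : ℕ} [NeZero k] (hk : k < n) {c : ℂ} (hc : c ≠ 0) :
    ∃ (N : Gr k n) (t : ℂˣ) (w : ℂ[X]), IsToeplitzPoint N t w ∧
      (-1) ^ (k - 1) * (t : ℂ) = c ^ n := by
  obtain ⟨N, w, hw, h⟩ := exists_realizes_toeplitz (Nat.pos_of_neZero k) hk hc
  have hsq : (-1 : ℂ) ^ (k - 1) * (-1) ^ (k - 1) = 1 := by
    rw [← mul_pow]
    simp
  have ht : (-1 : ℂ) ^ (k - 1) * ((-1) ^ (k - 1) * c ^ n) = c ^ n := by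
    rw [← mul_assoc, hsq, one_mul]
  refine ⟨N, Units.mk0 ((-1) ^ (k - 1) * c ^ n) fun h0 => ?_, w, ⟨hw, ?_⟩, ht⟩
  · rw [h0, mul_zero] at ht
    exact pow_ne_zero n hc ht.symm
  · rw [Units.val_mk0, ht]
    exact h

section Toeplitz

variable {n k ℓ : ℕ} {N : Gr k n} {t : ℂˣ} {w : ℂ[X]} {M : Gr ℓ n} {s : ℂˣ}
  {x : ℂ[X]} {Z : Matrix (Fin n) (Fin ℓ) ℂ} {W : Matrix (Fin n) (Fin k) ℂ}

theorem IsToeplitzPoint.cyclicNonzero (hk : k < n) (h : IsToeplitzPoint N t w) (hW : IsRep W N) :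
    CyclicNonzero W := (cyclicNonzero_iff hk.le hW).2 h.realizes.generic

theorem IsToeplitzPoint.gMatrix_eq [NeZero k] (hk : k < n) (h : IsToeplitzPoint N t w)
    (hW : IsRep W N) :
    gMatrix W t = toeplitz n w :=
  (realizes_gMatrix hk hW (h.cyclicNonzero hk hW) t).eq_of_band hk.le (neg_one_pow_mul_ne_zero k t)
    h.realizes.band h.realizes.col_mem

theorem IsToeplitzPoint.isRep_sMatrix [NeZero k] (hk : k < n) (h : IsToeplitzPoint N t w)
    (hW : IsRep W N) : IsRep (sMatrix hk.le W t) N := by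
  rw [sMatrix, h.gMatrix_eq hk hW, fl_toeplitz, IsRep, projMatrix, ← firstCols_eq_span]
  refine Submodule.eq_of_le_of_finrank_eq (firstCols_le h.realizes.col_mem) ?_
  rw [N.2, h.realizes.band.finrank_firstCols hk.le]

theorem IsToeplitzPoint.isRep_psiMatrix [NeZero k] [NeZero ℓ] (hk : k < n) (hℓ : ℓ < n)
    (h : IsToeplitzPoint N t w)
    (hW : IsRep W N) (h' : IsToeplitzPoint M s x) (hZ : IsRep Z M)
    (hne : (-1 : ℂ) ^ (k - 1) * (t : ℂ) ≠ (-1) ^ (ℓ - 1) * (s : ℂ)) :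
    IsRep (psiMatrix hk.le Z s W t) N := by
  rw [psiMatrix, h.gMatrix_eq hk hW, h'.gMatrix_eq hℓ hZ, IsRep, projMatrix, ← firstCols_eq_span]
  exact firstCols_mul_of_comm hk h.realizes (toeplitz_mul_comm h'.natDegree_lt h.natDegree_lt)
    (h'.realizes.isUnit_eval hℓ.le (neg_one_pow_mul_ne_zero ℓ s) hne)

end Toeplitz

theorem containsDenseOpen_dom_geomR {n ℓ k : ℕ} [NeZero ℓ] [NeZero k] (hℓ : ℓ < n) (hk : k < n) :
    ContainsDenseOpen {p : X n ℓ × X n k |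
      ∃ v' u', (v', u') ∈ geomR p ∧ (g v').Dom ∧ (g u').Dom} := by
  -- The bases `1` and `2` give the evaluation points `1` and `2^n`, which are distinct, as `Ψ`
  -- requires.
  obtain ⟨N₀, t₀, w, hN₀, ht₀⟩ := exists_isToeplitzPoint hk one_ne_zero
  obtain ⟨M₀, s₀, x, hM₀, hs₀⟩ := exists_isToeplitzPoint hℓ two_ne_zero
  have hne : (-1 : ℂ) ^ (k - 1) * (t₀ : ℂ) ≠ (-1) ^ (ℓ - 1) * (s₀ : ℂ) := by
    rw [ht₀, hs₀, one_pow]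
    intro h
    have h2 : (2 : ℕ) ^ n = 1 := by exact_mod_cast h.symm
    exact (Nat.one_lt_two_pow (by omega)).ne' h2
  have rZ₀ := rep_spec M₀
  have rW₀ := rep_spec N₀
  -- At the base point every intermediate matrix represents `M₀` or `N₀` again, so all seven
  -- nonvanishing conditions reduce to genericity of these two.
  have rΨ := hN₀.isRep_psiMatrix hk hℓ rW₀ hM₀ rZ₀ hne
  have rSZ := hM₀.isRep_sMatrix hℓ rZ₀
  have rSW := hN₀.isRep_sMatrix hk rW₀
  have rΨS := hM₀.isRep_psiMatrix hℓ hk rSZ hN₀ rSW hne.symm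
  have rSΨS := hM₀.isRep_sMatrix hℓ rΨS
  let Z : (Coord n ℓ k → ℂ) → Matrix (Fin n) (Fin ℓ) ℂ :=
    fun p => .of fun i j => p (.inl (.inl (i, j)))
  let W : (Coord n ℓ k → ℂ) → Matrix (Fin n) (Fin k) ℂ :=
    fun p => .of fun i j => p (.inr (.inl (i, j)))
  let s : (Coord n ℓ k → ℂ) → ℂ := fun p => p (.inl (.inr ()))
  let t : (Coord n ℓ k → ℂ) → ℂ := fun p => p (.inr (.inr ()))
  set p₀ : Coord n ℓ k → ℂ := coordVal (rep M₀) s₀ (rep N₀) t₀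
  have cZ := hM₀.cyclicNonzero hℓ rZ₀
  have cW := hN₀.cyclicNonzero hk rW₀
  have cΨ := hN₀.cyclicNonzero hk rΨ
  have cSZ := hM₀.cyclicNonzero hℓ rSZ
  have cSW := hN₀.cyclicNonzero hk rSW
  have cΨS := hM₀.cyclicNonzero hℓ rΨS
  have cSΨS := hM₀.cyclicNonzero hℓ rSΨS
  have eZ : ∀ i j, (fun p => Z p i j) ∈ regularAt p₀ := fun _ _ => coordinate_mem_regularAt _
  have eW : ∀ i j, (fun p => W p i j) ∈ regularAt p₀ := fun _ _ => coordinate_mem_regularAt _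
  have es : s ∈ regularAt p₀ := coordinate_mem_regularAt _
  have et : t ∈ regularAt p₀ := coordinate_mem_regularAt _
  have eΨ := psiMatrix_mem_regularAt hk.le eZ es cZ eW et cW
  have eSZ := sMatrix_mem_regularAt hℓ.le eZ es cZ
  have eSW := sMatrix_mem_regularAt hk.le eW et cW
  have eΨS := psiMatrix_mem_regularAt hℓ.le eSW et cSW eSZ es cSZ
  have eSΨS := sMatrix_mem_regularAt hℓ.le eΨS es cΨS
  obtain ⟨F, hF, hF'⟩ := eventually_zariskiNhds.1
    ((eventually_cyclicNonzero eZ cZ).and <| (eventually_cyclicNonzero eW cW).and <|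
      (eventually_cyclicNonzero eΨ cΨ).and <| (eventually_cyclicNonzero eSZ cSZ).and <|
      (eventually_cyclicNonzero eSW cSW).and <| (eventually_cyclicNonzero eΨS cΨS).and <|
      eventually_cyclicNonzero eSΨS cSΨS)
  -- `F` is nonzero because it is nonzero at `p₀`; the coordinates of a point are the entries of
  -- arbitrary representatives together with `s` and `t`.
  refine ⟨F, fun h0 => hF (by rw [h0, map_zero]), fun M s N t Z W hZ hW hp => ?_⟩
  obtain ⟨h1, h2, h3, h4, h5, h6, h7⟩ := hF' _ hp
  exact exists_mem_geomR hℓ hk hZ hW h1 h2 h3 h4 h5 h6 h7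

end GeomR

end

theorem mainTheorem1 (n ℓ k : ℕ) [NeZero ℓ] [NeZero k] (hℓ : ℓ < n) (hk : k < n) :
    (∀ (u : GeomR.X n ℓ) (v v' : GeomR.X n k) (u' : GeomR.X n ℓ),
      (v', u') ∈ GeomR.geomR (u, v) →
      ∀ B' ∈ GeomR.g v', ∀ A' ∈ GeomR.g u',
        ∃ A ∈ GeomR.g u, ∃ B ∈ GeomR.g v,
          GeomR.toLoop n A * GeomR.toLoop n B = GeomR.toLoop n B' * GeomR.toLoop n A') ∧
    GeomR.ContainsDenseOpen
      {p : GeomR.X n ℓ × GeomR.X n k |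
        ∃ v' u', (v', u') ∈ GeomR.geomR p ∧ (GeomR.g v').Dom ∧ (GeomR.g u').Dom} := by
  refine ⟨fun u v v' u' hR B' hB' A' hA' => ?_, GeomR.containsDenseOpen_dom_geomR hℓ hk⟩
  obtain ⟨A, hA, B, hB, h⟩ := GeomR.g_comp_geomR hℓ hk hR hB' hA'
  exact ⟨A, hA, B, hB, by rw [← map_mul, ← map_mul, h]⟩
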